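/- Let $(a_k)_{k\ge 1}$ and $(b_k)_{k\ge 1}$ be two independent centered stationary real Gaussian processes with the same correlation function $\rho:\mathbb N\to\mathbb R$, i.e. $\mathbb E[a_ka_l]=\mathbb E[b_kb_l]=\rho(|k-l|)$ for all $k,l\ge 1$. For $n\ge 1$ let \[ f_n(t)=\frac1{\sqrt n}\sum_{k=1}^n a_k\cos(kt)+b_k\sin(kt),\qquad t\in\mathbb R, \] and let $\mathcal N(f_n,[0,2\pi])$ be the number of zeros of $f_n$ in $[0,2\pi]$. Suppose that $\rho(k)=\int_{\mathbb R}e^{ik\xi}\,\mu(d\xi)$ for all $k\ge 0$, where the spectral measure $\mu$ has the form \[ \mu=(1-\eta)\mu_d+\eta\,\frac1N\sum_{k=1}^N\frac12\left(\delta_{\alpha_k}+\delta_{-\alpha_k}\right) \] with $\eta\in[0,1)$, $N\ge 1$, $\alpha_1,\dots,\alpha_N\ge 0$, and where $\mu_d$ has a density $\varphi$ with respect to the Lebesgue measure on $[0,2\pi]$ such that $\varphi$ is continuous on $(0,2\pi)$, $\inf_{[0,2\pi]}\varphi>0$ and $\sup_{[0,2\pi]}|\varphi|<+\infty$. Then \[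 \lim_{n\to+\infty}\frac{\mathbb E\left[\mathcal N(f_n,[0,2\pi])\right]}{n}=\frac{2}{\sqrt3}. \] -/

import Mathlib

open MeasureTheory ProbabilityTheory Filter Topology
open scoped ENNReal

namespace RandomTrig

noncomputable section

/-- `μ` is a spectral measure of the correlation function `ρ`: it is a finite measure on the real
line whose Fourier transform at the nonnegative integers is `ρ`. -/
def IsSpectralMeasure (μ : Measure ℝ) (ρ : ℕ → ℝ) : Prop :=
  IsFiniteMeasure μ ∧
    ∀ k : ℕ, ((ρ k : ℝ) : ℂ) = ∫ ξ : ℝ, Complex.exp (Complex.I * (k : ℂ) * (ξ : ℂ)) ∂μ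

/-- The measure on `[0, 2π]` with density `φ` with respect to the Lebesgue measure. -/
def densityMeasure (φ : ℝ → ℝ) : Measure ℝ :=
  (volume.restrict (Set.Icc 0 (2 * Real.pi))).withDensity (fun t => ENNReal.ofReal (φ t))

/-- The atomic measure `(1 / N) ∑ₖ (δ_{αₖ} + δ_{-αₖ}) / 2`. -/
def atomicMeasure {N : ℕ} (α : Fin N → ℝ) : Measure ℝ :=
  ((N : ℝ≥0∞)⁻¹) • ∑ k : Fin N,
    ((2 : ℝ≥0∞)⁻¹) • (Measure.dirac (α k) + Measure.dirac (-(α k)))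

/-- The mixed measure `(1 - η) μ_d + η (1 / N) ∑ₖ (δ_{αₖ} + δ_{-αₖ}) / 2`, where `μ_d` has
density `φ` on `[0, 2π]`. -/
def mixedMeasure (η : ℝ) (φ : ℝ → ℝ) {N : ℕ} (α : Fin N → ℝ) : Measure ℝ :=
  ENNReal.ofReal (1 - η) • densityMeasure φ + ENNReal.ofReal η • atomicMeasure α

variable {Ω : Type*} [MeasurableSpace Ω]

/-- `(a k)_{k ≥ 1}` is a centered stationary Gaussian process with correlation function `ρ`. -/
structure IsStationaryGaussian (a : ℕ+ → Ω → ℝ) (ρ : ℕ → ℝ) (P : Measure Ω) : Prop where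
  gaussian : IsGaussianProcess a P
  centered : ∀ k, ∫ ω, a k ω ∂P = 0
  correlation : ∀ k l : ℕ+, ∫ ω, a k ω * a l ω ∂P = ρ ((k : ℤ) - (l : ℤ)).natAbs

/-- The random trigonometric polynomial
`f_n(t) = (1 / √n) ∑_{k = 1}^n (a_k cos (k t) + b_k sin (k t))`;
the summation index `j = k - 1` runs over `0, …, n - 1`. -/
def trigPoly (a b : ℕ+ → Ω → ℝ) (n : ℕ) (ω : Ω) (t : ℝ) : ℝ :=
  (1 / Real.sqrt n) * ∑ j ∈ Finset.range n,
    (a j.succPNat ω * Real.cos (((j : ℝ) + 1) * t)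
      + b j.succPNat ω * Real.sin (((j : ℝ) + 1) * t))

/-- The number (possibly infinite) of zeros of `f` in the set `S`. -/
def numZeros (f : ℝ → ℝ) (S : Set ℝ) : ℝ≥0∞ :=
  (({t : ℝ | t ∈ S ∧ f t = 0}.encard : ℕ∞) : ℝ≥0∞)

end

end RandomTrig

/-! The proof combines the Kac–Rice formula with an approximate-identity argument for the spectral
measure.

Kac–Rice (`lintegral_numZeros_eq`). If `h` and `f` are independent copies of a centered Gaussian
function, `f + y h` is, up to a scalar, a copy of `f` by rotation invariance, and scalars do not
move zeros. The mean number of zeros is therefore also the mean for `f + y h` with `y` averaged over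
a Cauchy law. By the area formula for `-f / h`, this average is `1 / π` times the angular variation
of the planar curve `(h, f)`, whose mean speed is an explicit Gaussian integral. With `V`, `B`, `M`
the variances of the value and of the derivative and their covariance, the density of zeros is `π⁻¹
√((V B - M²) / V²)`.

Asymptotics. `V / n`, `B / n³` and `M / n²` at `t` are integrals over `ξ` against `μ` of kernels in
`ξ - t` (the Fejér kernel and two relatives) that concentrate at `0` with masses `2π`, `2π / 3` and
`0`. If `t` avoids the atoms modulo `2π`, the limits are `(1 - η) φ t` times these masses. The
factor `(1 - η) φ t` cancels, so the density divided by `n` tends to `1 / (π √3)` for almost every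
`t`, and integration over `[0, 2π]` gives `2 / √3`.

Exchange of limit and integral. The kernels blow up near the atoms, so a second-moment bound
replaces domination: the squared normalized density is at most a constant times the normalized
variance of the derivative, because `φ` is bounded below and `η < 1`, and the integral of that
variance over a period is at most `2π ρ 0`. Vitali's argument (`tendsto_integral_of_sq_bounded`)
concludes. -/

namespace RandomTrig

/-! ### Measurability of the number of zeros -/

open scoped NNReal

/-- The number of zeros is the supremum over scales of the number of cells that contain a zero. -/
lemma encard_eq_iSup_floor_image (Z : Set ℝ) :
    (Z.encard : ℝ≥0∞) = ⨆ m : ℕ, ((((fun t : ℝ => ⌊(m : ℝ) * t⌋) '' Z).encard : ℕ∞) : ℝ≥0∞) := by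
  have hfin : ∀ k : ℕ, (k : ℕ∞) ≤ Z.encard →
      ∃ m : ℕ, (k : ℕ∞) ≤ ((fun t : ℝ => ⌊(m : ℝ) * t⌋) '' Z).encard := by
    intro k hk
    obtain ⟨T, hTZ, hTk⟩ := Set.exists_subset_encard_eq hk
    have hT : T.Finite := Set.finite_of_encard_eq_coe hTk
    -- Cells of mesh `1 / m` separate two points as soon as `m` exceeds the inverse of their
    -- distance.
    have hev : ∀ᶠ m : ℕ in atTop, ∀ x ∈ T.offDiag, ⌊(m : ℝ) * x.1⌋ ≠ ⌊(m : ℝ) * x.2⌋ := by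
      rw [Filter.eventually_all_finite hT.offDiag]
      rintro ⟨x, y⟩ ⟨-, -, hxy⟩
      have hpos : 0 < |x - y| := abs_pos.2 (sub_ne_zero.2 hxy)
      obtain ⟨M, hM⟩ := exists_nat_gt (1 / |x - y|)
      filter_upwards [eventually_ge_atTop M] with m hm heq
      have h1 := Int.abs_sub_lt_one_of_floor_eq_floor heq
      have h2 : (1 : ℝ) < m * |x - y| := by
        rw [div_lt_iff₀ hpos] at hM
        exact hM.trans_le (by gcongr)
      rw [← mul_sub, abs_mul, Nat.abs_cast] at h1
      linarith
    obtain ⟨m, hm⟩ := hev.exists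
    refine ⟨m, ?_⟩
    have hinj : Set.InjOn (fun t : ℝ => ⌊(m : ℝ) * t⌋) T := by
      intro x hx y hy hxy
      by_contra hne
      exact hm (x, y) ⟨hx, hy, hne⟩ hxy
    rw [← hTk, ← hinj.encard_image]
    exact Set.encard_le_encard (Set.image_mono hTZ)
  apply le_antisymm
  · refine ENNReal.le_of_forall_nnreal_lt fun r hr => ?_
    obtain ⟨k, hk, hkZ⟩ : ∃ k : ℕ, (r : ℝ≥0∞) ≤ k ∧ (k : ℕ∞) ≤ Z.encard := by
      rcases eq_or_ne Z.encard ⊤ with h | h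
      · obtain ⟨k, hk⟩ := exists_nat_ge r
        exact ⟨k, by exact_mod_cast hk, by simp [h]⟩
      · obtain ⟨k, hk⟩ := ENat.ne_top_iff_exists.1 h
        refine ⟨k, ?_, hk.le⟩
        rw [← hk] at hr
        exact hr.le
    obtain ⟨m, hm⟩ := hfin k hkZ
    refine hk.trans (le_trans ?_ (le_iSup _ m))
    exact_mod_cast ENat.toENNReal_le.2 hm
  · refine iSup_le fun m => ?_
    exact_mod_cast Set.encard_image_le _ _

/-- Since `K` is compact, not vanishing anywhere on `K` is an open condition on `c`. -/
lemma measurableSet_exists_zero {E : Type*} [TopologicalSpace E] [MeasurableSpace E]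
    [OpensMeasurableSpace E] {F : E → ℝ → ℝ} (hF : Continuous (Function.uncurry F))
    {K : Set ℝ} (hK : IsCompact K) : MeasurableSet {c | ∃ t ∈ K, F c t = 0} := by
  have : IsOpen {c | ∀ t ∈ K, F c t ≠ 0} := by
    rw [isOpen_iff_eventually]
    intro c hc
    apply hK.eventually_forall_of_forall_eventually
    intro t ht
    exact (hF.tendsto (c, t)).eventually_ne (hc t ht)
  convert this.measurableSet.compl using 1
  ext c
  simp

lemma measurable_numZeros {E : Type*} [TopologicalSpace E] [MeasurableSpace E]
    [OpensMeasurableSpace E] {F : E → ℝ → ℝ} (hF : Continuous (Function.uncurry F)) (p q : ℝ) :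
    Measurable fun c => numZeros (F c) (Set.Icc p q) := by
  unfold numZeros
  simp_rw [encard_eq_iSup_floor_image]
  refine Measurable.iSup fun m => ?_
  have hB : ∀ j : ℤ, MeasurableSet {c | ∃ t ∈ Set.Icc p q, F c t = 0 ∧ ⌊(m : ℝ) * t⌋ = j} := by
    intro j
    -- The cells are half-open, hence not compact; closed cells with right end shortened by `1 / (k
    -- + 1)` exhaust them.
    have : {c | ∃ t ∈ Set.Icc p q, F c t = 0 ∧ ⌊(m : ℝ) * t⌋ = j} =
        ⋃ k : ℕ, {c | ∃ t ∈ Set.Icc p q ∩ {t | (j : ℝ) ≤ m * t ∧ m * t ≤ j + 1 - 1 / (k + 1 : ℝ)},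
          F c t = 0} := by
      ext c
      simp only [Set.mem_ofPred_eq, Set.mem_iUnion, Set.mem_inter_iff, Int.floor_eq_iff]
      constructor
      · rintro ⟨t, ht, h0, h1, h2⟩
        obtain ⟨k, hk⟩ := exists_nat_one_div_lt (sub_pos.2 h2)
        exact ⟨k, t, ⟨ht, h1, by linarith⟩, h0⟩
      · rintro ⟨k, t, ⟨ht, h1, h2⟩, h0⟩
        have : (0 : ℝ) < 1 / (k + 1 : ℝ) := by positivity
        exact ⟨t, ht, h0, h1, by linarith⟩
    rw [this]
    refine MeasurableSet.iUnion fun k => measurableSet_exists_zero hF ?_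
    refine isCompact_Icc.inter_right ?_
    exact (isClosed_le (f := fun _ : ℝ => (j : ℝ)) (g := fun t : ℝ => m * t)
      (by fun_prop) (by fun_prop)).inter (isClosed_le (f := fun t : ℝ => m * t)
        (g := fun _ : ℝ => (j + 1 - 1 / (k + 1 : ℝ) : ℝ)) (by fun_prop) (by fun_prop))
  have key : ∀ c, (((((fun t : ℝ => ⌊(m : ℝ) * t⌋) '' {t | t ∈ Set.Icc p q ∧ F c t = 0}).encard :
      ℕ∞)) : ℝ≥0∞) = ∑' j : ℤ, Set.indicator
        {c | ∃ t ∈ Set.Icc p q, F c t = 0 ∧ ⌊(m : ℝ) * t⌋ = j} 1 c := by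
    intro c
    rw [← ENNReal.tsum_set_one, tsum_subtype _ (fun _ => (1 : ℝ≥0∞))]
    refine tsum_congr fun j => ?_
    have hiff : j ∈ (fun t : ℝ => ⌊(m : ℝ) * t⌋) '' {t | t ∈ Set.Icc p q ∧ F c t = 0} ↔
        c ∈ {c | ∃ t ∈ Set.Icc p q, F c t = 0 ∧ ⌊(m : ℝ) * t⌋ = j} :=
      ⟨fun ⟨t, ⟨ht, h0⟩, h⟩ => ⟨t, ht, h0, h⟩, fun ⟨t, ht, h0, h⟩ => ⟨t, ⟨ht, h0⟩, h⟩⟩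
    by_cases h : j ∈ (fun t : ℝ => ⌊(m : ℝ) * t⌋) '' {t | t ∈ Set.Icc p q ∧ F c t = 0}
    · rw [Set.indicator_of_mem h, Set.indicator_of_mem (hiff.1 h), Pi.one_apply]
    · rw [Set.indicator_of_notMem h, Set.indicator_of_notMem (mt hiff.2 h)]
  simp_rw [key]
  exact Measurable.tsum fun j => measurable_one.indicator (hB j)

/-! ### The area formula in dimension one -/

lemma encard_iUnion_eq_tsum {W : ℕ → Set ℝ} (hW : Pairwise (Function.onFun Disjoint W)) :
    ((⋃ i, W i).encard : ℝ≥0∞) = ∑' i, ((W i).encard : ℝ≥0∞) := by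
  simp_rw [← ENNReal.tsum_set_one]
  have := ENNReal.tsum_biUnion (f := fun _ : ℝ => (1 : ℝ≥0∞)) (t := W)
    (fun i _ j _ hij => hW hij)
  exact this

/-- The area formula on the real line. -/
lemma lintegral_encard_fiber_mul {g g' : ℝ → ℝ} {U A : Set ℝ} (hU : IsOpen U)
    (hg : ∀ t ∈ U, HasDerivAt g (g' t) t) (hg' : ContinuousOn g' U) (hA : MeasurableSet A)
    (hAU : A ⊆ U) {w : ℝ → ℝ≥0∞} (hw : Measurable w) :
    ∫⁻ y, ({t | t ∈ A ∧ g t = y}.encard : ℝ≥0∞) * w y =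
      ∫⁻ t in A, ENNReal.ofReal |g' t| * w (g t) := by
  classical
  have hO : IsOpen (U ∩ {t | g' t ≠ 0}) := hg'.isOpen_inter_preimage hU isOpen_ne
  set O := U ∩ {t | g' t ≠ 0} with hOdef
  -- The empty set serves outside `O`, so that `W t` is injective for every `t`, including the index
  -- `0` inserted below to make the countable family nonempty.
  have hloc : ∀ t, ∃ W : Set ℝ, IsOpen W ∧ (t ∈ O → t ∈ W) ∧ Set.InjOn g W := by
    intro t
    by_cases htO : t ∈ O
    swap
    · exact ⟨∅, isOpen_empty, fun h => absurd h htO, Set.injOn_empty g⟩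
    obtain ⟨ht, ht0⟩ := htO
    have hs : HasStrictDerivAt g (g' t) t := by
      refine hasStrictDerivAt_of_hasDerivAt_of_continuousAt ?_ (hg'.continuousAt (hU.mem_nhds ht))
      filter_upwards [hU.mem_nhds ht] with s hs using hg s hs
    let e := (hs.hasStrictFDerivAt_equiv ht0).toOpenPartialHomeomorph g
    exact ⟨e.source, e.open_source,
      fun _ => (hs.hasStrictFDerivAt_equiv ht0).mem_toOpenPartialHomeomorph_source, e.injOn⟩
  choose W hWo hWm hWi using hloc
  obtain ⟨T, hTU, hTc, hTcov⟩ := TopologicalSpace.countable_cover_nhdsWithin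
    (f := W) (s := O)
    (fun t ht => mem_nhdsWithin_of_mem_nhds ((hWo t).mem_nhds (hWm t ht)))
  obtain ⟨e, he⟩ := (hTc.insert 0).exists_eq_range (Set.insert_nonempty _ _)
  set D : ℕ → Set ℝ := fun i => A ∩ O ∩ disjointed (fun j => W (e j)) i with hD
  have hDdisj : Pairwise (Function.onFun Disjoint D) := fun i j hij =>
    (disjoint_disjointed (fun j => W (e j)) hij).mono Set.inter_subset_right Set.inter_subset_right
  have hDmeas : ∀ i, MeasurableSet (D i) := fun i =>
    (hA.inter hO.measurableSet).inter
      (MeasurableSet.disjointed (fun j => (hWo (e j)).measurableSet) i)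
  have hDinj : ∀ i, Set.InjOn g (D i) := fun i =>
    (hWi (e i)).mono (Set.inter_subset_right.trans (disjointed_subset (fun j => W (e j)) i))
  have hDU : ⋃ i, D i = A ∩ O := by
    rw [hD, ← Set.inter_iUnion, iUnion_disjointed, Set.inter_eq_left]
    intro t ht
    obtain ⟨s, hs, hts⟩ := Set.mem_iUnion₂.1 (hTcov ht.2)
    obtain ⟨j, rfl⟩ : s ∈ Set.range e := he ▸ Set.mem_insert_of_mem _ hs
    exact Set.mem_iUnion.2 ⟨j, hts⟩
  have hder : ∀ i, ∀ t ∈ D i, HasDerivWithinAt g (g' t) (D i) t := fun i t ht =>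
    (hg t ht.1.2.1).hasDerivWithinAt
  have himg : ∀ i, MeasurableSet (g '' D i) := fun i =>
    measurable_image_of_fderivWithin (hDmeas i) (fun t ht => (hder i t ht).hasFDerivWithinAt)
      (hDinj i)
  -- Sard's theorem on the line: critical values are negligible, so almost every fiber lies in `O`,
  -- where the pieces `D i` make `g` injective.
  have hcrit : volume (g '' (A \ O)) = 0 := by
    refine addHaar_image_eq_zero_of_det_fderivWithin_eq_zero volume
      (f' := fun t => ContinuousLinearMap.toSpanSingleton ℝ (g' t))
      (fun t ht => (hg t (hAU ht.1)).hasDerivWithinAt.hasFDerivWithinAt) fun t ht => ?_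
    have : g' t = 0 := by
      by_contra h
      exact ht.2 ⟨hAU ht.1, h⟩
    simp [this]
  have hcount : ∀ᵐ y, ({t | t ∈ A ∧ g t = y}.encard : ℝ≥0∞) * w y =
      ∑' i, (g '' D i).indicator w y := by
    filter_upwards [compl_mem_ae_iff.2 hcrit] with y hy
    have h1 : {t | t ∈ A ∧ g t = y} = ⋃ i, {t | t ∈ D i ∧ g t = y} := by
      ext t
      simp only [Set.mem_ofPred_eq, Set.mem_iUnion]
      constructor
      · rintro ⟨htA, rfl⟩
        have htO : t ∈ O := by
          by_contra h
          exact hy ⟨t, ⟨htA, h⟩, rfl⟩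
        have : t ∈ ⋃ i, D i := hDU ▸ ⟨htA, htO⟩
        obtain ⟨i, hi⟩ := Set.mem_iUnion.1 this
        exact ⟨i, hi, rfl⟩
      · rintro ⟨i, hi, h⟩
        exact ⟨hi.1.1, h⟩
    rw [h1, encard_iUnion_eq_tsum, ← ENNReal.tsum_mul_right]
    · refine tsum_congr fun i => ?_
      by_cases hyi : y ∈ g '' D i
      · obtain ⟨t, ht, rfl⟩ := hyi
        have : {s | s ∈ D i ∧ g s = g t} = {t} := by
          ext s
          simp only [Set.mem_ofPred_eq, Set.mem_singleton_iff]
          exact ⟨fun h => hDinj i h.1 ht h.2, fun h => by rw [h]; exact ⟨ht, rfl⟩⟩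
        rw [this, Set.indicator_of_mem (Set.mem_image_of_mem g ht)]
        simp
      · have : {s | s ∈ D i ∧ g s = y} = ∅ := by
          ext s
          simp only [Set.mem_ofPred_eq, Set.mem_empty_iff_false, iff_false]
          exact fun h => hyi ⟨s, h.1, h.2⟩
        rw [this, Set.indicator_of_notMem hyi]
        simp
    · exact fun i j hij => (hDdisj hij).mono (fun t ht => ht.1) (fun t ht => ht.1)
  rw [lintegral_congr_ae hcount, lintegral_tsum fun i => (hw.indicator (himg i)).aemeasurable]
  simp_rw [lintegral_indicator (himg _)]
  have hA2 : ∫⁻ t in A, ENNReal.ofReal |g' t| * w (g t) =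
      ∫⁻ t in A ∩ O, ENNReal.ofReal |g' t| * w (g t) := by
    rw [← lintegral_inter_add_sdiff _ A hO.measurableSet]
    conv_rhs => rw [← add_zero (∫⁻ t in A ∩ O, ENNReal.ofReal |g' t| * w (g t))]
    congr 1
    rw [setLIntegral_congr_fun (g := fun _ => 0) (hA.diff hO.measurableSet)]
    · simp
    · intro t ht
      have : g' t = 0 := by
        by_contra h
        exact ht.2 ⟨hAU ht.1, h⟩
      simp [this]
  rw [hA2, ← hDU, lintegral_iUnion hDmeas hDdisj]
  exact tsum_congr fun i =>
    lintegral_image_eq_lintegral_abs_deriv_mul (hDmeas i) (hder i) (hDinj i) w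

end RandomTrig

/-! ### Gaussian integrals in the plane -/

namespace RandomTrig

open scoped NNReal

/-- The first absolute moment of a centered Gaussian. -/
lemma lintegral_abs_gaussianReal (v : ℝ≥0) :
    ∫⁻ x, ENNReal.ofReal |x| ∂(gaussianReal 0 v) = ENNReal.ofReal √(2 * v / Real.pi) := by
  rcases eq_or_ne v 0 with rfl | hv
  · simp [gaussianReal_zero_var]
  have hv' : (0 : ℝ) < v := NNReal.coe_pos.2 (pos_iff_ne_zero.2 hv)
  have hint : ∫ x : ℝ, |x| * Real.exp (-(1 / (2 * v)) * x ^ 2) = 2 * v := by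
    have h := integral_comp_abs (f := fun x : ℝ => x * Real.exp (-(1 / (2 * v)) * x ^ 2))
    simp only [sq_abs] at h
    have h2 := integral_rpow_mul_exp_neg_mul_rpow (p := 2) (q := 1) (b := 1 / (2 * (v : ℝ)))
      (by norm_num) (by norm_num) (by positivity)
    norm_num at h2
    rw [h]
    have h3 : ∀ x : ℝ, -(1 / (2 * (v : ℝ))) * x ^ 2 = -((v : ℝ)⁻¹ * (1 / 2) * x ^ 2) := by
      intro x; field_simp
    simp_rw [h3, h2, Real.rpow_neg_one]
    field_simp
  have hI : Integrable fun x : ℝ => |x| * Real.exp (-(1 / (2 * v)) * x ^ 2) :=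
    Integrable.of_integral_ne_zero (by rw [hint]; positivity)
  rw [gaussianReal_of_var_ne_zero _ hv,
    lintegral_withDensity_eq_lintegral_mul _ (measurable_gaussianPDF 0 v) (by fun_prop)]
  have hpt : ∀ x : ℝ, (gaussianPDF 0 v * fun x => ENNReal.ofReal |x|) x =
      ENNReal.ofReal ((√(2 * Real.pi * v))⁻¹ * (|x| * Real.exp (-(1 / (2 * v)) * x ^ 2))) := by
    intro x
    rw [Pi.mul_apply, gaussianPDF, ← ENNReal.ofReal_mul (gaussianPDFReal_nonneg _ _ _),
      gaussianPDFReal, sub_zero, mul_assoc, mul_comm |x|]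
    congr 4
    field_simp
  simp_rw [hpt]
  rw [← ofReal_integral_eq_lintegral_ofReal (hI.const_mul _)
    (Eventually.of_forall fun x => by positivity), integral_const_mul, hint]
  congr 1
  rw [eq_comm, Real.sqrt_eq_iff_mul_self_eq (by positivity) (by positivity)]
  have := Real.mul_self_sqrt (show 0 ≤ 2 * Real.pi * v by positivity)
  symm
  calc _ = (√(2 * Real.pi * v) * √(2 * Real.pi * v))⁻¹ * (2 * v) ^ 2 := by
        rw [mul_inv]; ring
    _ = _ := by rw [this]; field_simp

/-- The moment of order `-1` of the norm of a centered isotropic Gaussian vector in the plane. -/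
lemma lintegral_inv_norm_gaussianReal {v : ℝ≥0} (hv : v ≠ 0) :
    ∫⁻ p : ℝ × ℝ, ENNReal.ofReal (√(p.1 ^ 2 + p.2 ^ 2))⁻¹ ∂((gaussianReal 0 v).prod (gaussianReal 0 v)) =
      ENNReal.ofReal √(Real.pi / (2 * v)) := by
  have hv' : (0 : ℝ) < v := NNReal.coe_pos.2 (pos_iff_ne_zero.2 hv)
  have hmeas : ∀ (m : ℝ) (v : ℝ≥0),
      Measurable fun p : ℝ × ℝ => gaussianPDF m v p.1 * gaussianPDF m v p.2 := fun m v =>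
    ((measurable_gaussianPDF m v).comp measurable_fst).mul
      ((measurable_gaussianPDF m v).comp measurable_snd)
  -- The plane is viewed as `ℂ`; the exponent `-1` exceeds `-2`, so the singularity at the origin is
  -- integrable.
  have hint := Complex.integral_rpow_mul_exp_neg_mul_rpow (p := 2) (q := -1)
    (b := 1 / (2 * (v : ℝ))) (by norm_num) (by norm_num) (by positivity)
  norm_num at hint
  rw [Real.Gamma_one_half_eq] at hint
  have hI : Integrable fun z : ℂ => ‖z‖ ^ (-1 : ℝ) * Real.exp (-((v : ℝ)⁻¹ * (1 / 2) * ‖z‖ ^ 2)) :=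
    Integrable.of_integral_ne_zero (by rw [hint]; positivity)
  rw [gaussianReal_of_var_ne_zero _ hv,
    prod_withDensity (measurable_gaussianPDF 0 v) (measurable_gaussianPDF 0 v),
    lintegral_withDensity_eq_lintegral_mul _ (hmeas 0 v) (by fun_prop),
    ← Measure.volume_eq_prod, ← Complex.volume_preserving_equiv_real_prod.lintegral_comp (by fun_prop)]
  have hpt : ∀ z : ℂ, ((fun p : ℝ × ℝ => gaussianPDF 0 v p.1 * gaussianPDF 0 v p.2) *
      fun p : ℝ × ℝ => ENNReal.ofReal (√(p.1 ^ 2 + p.2 ^ 2))⁻¹) (Complex.measurableEquivRealProd z) =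
      ENNReal.ofReal ((2 * Real.pi * v)⁻¹ *
        (‖z‖ ^ (-1 : ℝ) * Real.exp (-((v : ℝ)⁻¹ * (1 / 2) * ‖z‖ ^ 2)))) := by
    intro z
    simp only [Pi.mul_apply, Complex.measurableEquivRealProd_apply, gaussianPDF]
    rw [← ENNReal.ofReal_mul (gaussianPDFReal_nonneg _ _ _), ← ENNReal.ofReal_mul
      (mul_nonneg (gaussianPDFReal_nonneg _ _ _) (gaussianPDFReal_nonneg _ _ _))]
    congr 1
    have hn : ‖z‖ = √(z.re ^ 2 + z.im ^ 2) := by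
      rw [Complex.norm_eq_sqrt_sq_add_sq]
    have hsq := Real.mul_self_sqrt (show 0 ≤ 2 * Real.pi * v by positivity)
    simp only [gaussianPDFReal, sub_zero]
    rw [Real.rpow_neg_one, ← hn]
    have he : Real.exp (-((v : ℝ)⁻¹ * (1 / 2) * ‖z‖ ^ 2)) =
        Real.exp (-z.re ^ 2 / (2 * v)) * Real.exp (-z.im ^ 2 / (2 * v)) := by
      rw [← Real.exp_add, hn, Real.sq_sqrt (by positivity)]
      congr 1
      field_simp
      ring
    rw [he]
    nth_rw 3 [← hsq]
    rw [mul_inv]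
    ring
  rw [lintegral_congr hpt, ← ofReal_integral_eq_lintegral_ofReal (hI.const_mul _)
    (Eventually.of_forall fun x => by positivity), integral_const_mul, hint]
  congr 1
  rw [eq_comm, Real.sqrt_eq_iff_mul_self_eq (by positivity) (by positivity)]
  have h1 : (((v : ℝ)⁻¹ * (1 / 2)) ^ (-(1 / 2) : ℝ)) * (((v : ℝ)⁻¹ * (1 / 2)) ^ (-(1 / 2) : ℝ)) =
      2 * v := by
    rw [← Real.rpow_add (by positivity)]
    norm_num
    rw [Real.rpow_neg_one]
    field_simp
  have h2 := Real.mul_self_sqrt Real.pi_pos.le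
  symm
  calc _ = ((2 * Real.pi * v)⁻¹ * Real.pi) ^ 2 * ((((v : ℝ)⁻¹ * (1 / 2)) ^ (-(1 / 2) : ℝ)) *
        (((v : ℝ)⁻¹ * (1 / 2)) ^ (-(1 / 2) : ℝ))) * (√Real.pi * √Real.pi) := by ring
    _ = _ := by rw [h1, h2]; field_simp

/-- A linear combination of independent centered Gaussians is again one, here of variance `(x ^ 2 +
y ^ 2) * τ`. -/
lemma lintegral_abs_bilin_gaussianReal (τ : ℝ≥0) (x y : ℝ) :
    ∫⁻ p, ENNReal.ofReal |x * p.2 - p.1 * y| ∂((gaussianReal 0 τ).prod (gaussianReal 0 τ)) =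
      ENNReal.ofReal (√(2 * τ / Real.pi) * √(x ^ 2 + y ^ 2)) := by
  have hm : ((gaussianReal 0 τ).prod (gaussianReal 0 τ)).map
      (fun p : ℝ × ℝ => x * p.2 - p.1 * y) = gaussianReal 0 (Real.toNNReal (x ^ 2 + y ^ 2) * τ) := by
    have hX : HasLaw (fun p : ℝ × ℝ => p.1) (gaussianReal 0 τ)
        ((gaussianReal 0 τ).prod (gaussianReal 0 τ)) := ⟨by fun_prop, Measure.map_fst_prod.trans (by simp)⟩
    have hY : HasLaw (fun p : ℝ × ℝ => p.2) (gaussianReal 0 τ)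
        ((gaussianReal 0 τ).prod (gaussianReal 0 τ)) := ⟨by fun_prop, Measure.map_snd_prod.trans (by simp)⟩
    have hind : IndepFun (fun p : ℝ × ℝ => x * p.2) (fun p : ℝ × ℝ => (-y) * p.1)
        ((gaussianReal 0 τ).prod (gaussianReal 0 τ)) :=
      (indepFun_prod (X := fun a => (-y) * a) (Y := fun a => x * a) (by fun_prop) (by fun_prop)).symm
    have := gaussianReal_add_gaussianReal_of_indepFun hind
      (gaussianReal_const_mul hY x).map_eq (gaussianReal_const_mul hX (-y)).map_eq
    convert this using 1
    · congr 1
      ext p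
      simp
      ring
    · congr 1
      · simp
      · ext
        push_cast
        rw [Real.coe_toNNReal _ (by positivity)]
        ring
  have : ∫⁻ p, ENNReal.ofReal |x * p.2 - p.1 * y| ∂((gaussianReal 0 τ).prod (gaussianReal 0 τ)) =
      ∫⁻ z, ENNReal.ofReal |z| ∂(((gaussianReal 0 τ).prod (gaussianReal 0 τ)).map
      (fun p : ℝ × ℝ => x * p.2 - p.1 * y)) := by
    rw [lintegral_map (by fun_prop) (by fun_prop)]
  rw [this, hm, lintegral_abs_gaussianReal, ← Real.sqrt_mul (by positivity)]
  congr 2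
  push_cast
  rw [Real.coe_toNNReal _ (by positivity)]
  ring

/-- The mean angular speed of a planar Gaussian curve with independent position and velocity. -/
lemma lintegral_angular_gaussianReal {v : ℝ≥0} (hv : v ≠ 0) (τ : ℝ≥0) :
    ∫⁻ p, ENNReal.ofReal (|p.1.1 * p.2.2 - p.1.2 * p.2.1| / (p.1.1 ^ 2 + p.2.1 ^ 2))
      ∂(((gaussianReal 0 v).prod (gaussianReal 0 τ)).prod
        ((gaussianReal 0 v).prod (gaussianReal 0 τ))) = ENNReal.ofReal √(τ / v) := by
  -- For fixed positions the velocities are integrated first, giving `√(2 τ / π)` times the norm of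
  -- the position. Against the squared norm in the denominator this leaves the inverse norm, of mean
  -- `√(π / (2 v))`.
  rw [lintegral_prod _ (by fun_prop)]
  rw [lintegral_prod _ (Measurable.aemeasurable (Measurable.lintegral_prod_right'
    (f := fun p : (ℝ × ℝ) × ℝ × ℝ =>
      ENNReal.ofReal (|p.1.1 * p.2.2 - p.1.2 * p.2.1| / (p.1.1 ^ 2 + p.2.1 ^ 2))) (by fun_prop)))]
  have h1 : ∀ x b, ∫⁻ q : ℝ × ℝ, ENNReal.ofReal (|x * q.2 - b * q.1| / (x ^ 2 + q.1 ^ 2))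
      ∂((gaussianReal 0 v).prod (gaussianReal 0 τ)) = ∫⁻ c, ∫⁻ d,
        ENNReal.ofReal (|x * d - b * c| / (x ^ 2 + c ^ 2)) ∂(gaussianReal 0 τ) ∂(gaussianReal 0 v) :=
    fun x b => lintegral_prod _ (by fun_prop)
  simp_rw [h1]
  have h3 : ∀ x, ∫⁻ b, ∫⁻ c, ∫⁻ d, ENNReal.ofReal (|x * d - b * c| / (x ^ 2 + c ^ 2))
      ∂(gaussianReal 0 τ) ∂(gaussianReal 0 v) ∂(gaussianReal 0 τ) = ∫⁻ c,
      ∫⁻ p : ℝ × ℝ, ENNReal.ofReal (|x * p.2 - p.1 * c| / (x ^ 2 + c ^ 2))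
        ∂((gaussianReal 0 τ).prod (gaussianReal 0 τ)) ∂(gaussianReal 0 v) := by
    intro x
    rw [lintegral_lintegral_swap]
    · exact lintegral_congr fun c => (lintegral_prod (fun p : ℝ × ℝ =>
        ENNReal.ofReal (|x * p.2 - p.1 * c| / (x ^ 2 + c ^ 2))) (by fun_prop)).symm
    · apply Measurable.aemeasurable
      apply Measurable.lintegral_prod_right' (f := fun q : (ℝ × ℝ) × ℝ =>
        ENNReal.ofReal (|x * q.2 - q.1.1 * q.1.2| / (x ^ 2 + q.1.2 ^ 2)))
      fun_prop
  simp_rw [h3]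
  have h2 : ∀ x : ℝ × ℝ, ∫⁻ y, ENNReal.ofReal (|x.1 * y.2 - y.1 * x.2| / (x.1 ^ 2 + x.2 ^ 2))
      ∂((gaussianReal 0 τ).prod (gaussianReal 0 τ)) =
      ENNReal.ofReal √(2 * τ / Real.pi) * ENNReal.ofReal (√(x.1 ^ 2 + x.2 ^ 2))⁻¹ := by
    intro x
    simp_rw [div_eq_mul_inv, ENNReal.ofReal_mul (abs_nonneg _)]
    rw [lintegral_mul_const _ (by fun_prop), lintegral_abs_bilin_gaussianReal,
      ← ENNReal.ofReal_mul (by positivity), ← ENNReal.ofReal_mul (by positivity), mul_assoc,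
      ← div_eq_mul_inv √(x.1 ^ 2 + x.2 ^ 2), Real.sqrt_div_self', one_div, div_eq_mul_inv]
  have h5 := lintegral_prod (μ := gaussianReal 0 v) (ν := gaussianReal 0 v) (fun x : ℝ × ℝ =>
      ENNReal.ofReal √(2 * τ / Real.pi) * ENNReal.ofReal (√(x.1 ^ 2 + x.2 ^ 2))⁻¹) (by fun_prop)
  simp only at h5
  have h4 : ∀ x c : ℝ, ∫⁻ p : ℝ × ℝ, ENNReal.ofReal (|x * p.2 - p.1 * c| / (x ^ 2 + c ^ 2))
      ∂((gaussianReal 0 τ).prod (gaussianReal 0 τ)) =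
      ENNReal.ofReal √(2 * τ / Real.pi) * ENNReal.ofReal (√(x ^ 2 + c ^ 2))⁻¹ :=
    fun x c => h2 (x, c)
  simp_rw [h4]
  rw [← h5, lintegral_const_mul _ (by fun_prop), lintegral_inv_norm_gaussianReal hv,
    ← ENNReal.ofReal_mul (by positivity), ← Real.sqrt_mul (by positivity)]
  congr 2
  have : (v : ℝ) ≠ 0 := by exact_mod_cast hv
  field_simp

end RandomTrig

/-! ### The Kac–Rice formula -/

namespace RandomTrig

open scoped NNReal

section Gaussian

variable {E : Type*} [NormedAddCommGroup E] [NormedSpace ℝ E] [MeasurableSpace E] [BorelSpace E]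
  [SecondCountableTopology E] [CompleteSpace E] {ν : Measure E} [IsGaussian ν]

lemma integral_strongDual_eq_zero (hν : ∫ x, x ∂ν = 0) (l : StrongDual ℝ E) : ∫ x, l x ∂ν = 0 := by
  have := ContinuousLinearMap.integral_comp_comm l (IsGaussian.integrable_id (μ := ν))
  simp only [id_eq, hν, map_zero] at this
  exact this

lemma map_strongDual_eq_gaussianReal (hν : ∫ x, x ∂ν = 0) (l : StrongDual ℝ E) :
    ν.map l = gaussianReal 0 (∫ x, l x ^ 2 ∂ν).toNNReal := by
  have h : HasGaussianLaw (fun x => l x) ν := (IsGaussian.hasGaussianLaw_id (μ := ν)).map l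
  have := h.map_eq_gaussianReal
  rw [integral_strongDual_eq_zero hν, variance_of_integral_eq_zero (by fun_prop)
    (integral_strongDual_eq_zero hν l)] at this
  exact this

omit [SecondCountableTopology E] [CompleteSpace E] in
lemma integrable_strongDual_mul (l l' : StrongDual ℝ E) : Integrable (fun x => l x * l' x) ν := by
  have h : ∀ l : StrongDual ℝ E, MemLp (fun x => l x) 2 ν := fun l =>
    ((IsGaussian.hasGaussianLaw_id (μ := ν)).map l).memLp_two
  exact (h l).integrable_mul (h l')

lemma map_prod_strongDual_eq (hν : ∫ x, x ∂ν = 0) {l g : StrongDual ℝ E}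
    (h : ∫ x, l x * g x ∂ν = 0) :
    ν.map (fun x => (l x, g x)) = (gaussianReal 0 (∫ x, l x ^ 2 ∂ν).toNNReal).prod
      (gaussianReal 0 (∫ x, g x ^ 2 ∂ν).toNNReal) := by
  have hlaw : HasGaussianLaw (fun x => (l x, g x)) ν :=
    (IsGaussian.hasGaussianLaw_id (μ := ν)).map (l.prod g)
  have hind : IndepFun (fun x => l x) (fun x => g x) ν := by
    refine hlaw.indepFun_of_covariance_eq_zero ?_
    rw [covariance_eq_sub hlaw.fst.memLp_two hlaw.snd.memLp_two, integral_strongDual_eq_zero hν]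
    simp [h]
  rw [(indepFun_iff_map_prod_eq_prod_map_map (by fun_prop) (by fun_prop)).1 hind]
  congr 1
  · exact map_strongDual_eq_gaussianReal hν l
  · exact map_strongDual_eq_gaussianReal hν g

/-- The mean angular speed of the planar curve formed by two independent copies of a centered
Gaussian process with position `l` and velocity `l'`. -/
lemma lintegral_angular (hν : ∫ x, x ∂ν = 0) (l l' : StrongDual ℝ E)
    (hV : 0 < ∫ x, l x ^ 2 ∂ν) :
    ∫⁻ p, ENNReal.ofReal (|l p.1 * l' p.2 - l' p.1 * l p.2| / (l p.1 ^ 2 + l p.2 ^ 2)) ∂(ν.prod ν) =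
      ENNReal.ofReal √(((∫ x, l x ^ 2 ∂ν) * (∫ x, l' x ^ 2 ∂ν) - (∫ x, l x * l' x ∂ν) ^ 2) /
        (∫ x, l x ^ 2 ∂ν) ^ 2) := by
  set V := ∫ x, l x ^ 2 ∂ν with hVdef
  set M := ∫ x, l x * l' x ∂ν with hMdef
  set B := ∫ x, l' x ^ 2 ∂ν with hBdef
  -- Gaussian regression: `g` is uncorrelated with `l`, hence independent of it, and replacing `l'`
  -- by `g` does not change the antisymmetric form `l p.1 * l' p.2 - l' p.1 * l p.2`.
  set g : StrongDual ℝ E := l' - (M / V) • l with hg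
  have hgx : ∀ x, g x = l' x - (M / V) * l x := fun x => by simp [hg]
  have i1 := integrable_strongDual_mul (ν := ν) l l'
  have i2 := integrable_strongDual_mul (ν := ν) l l
  have i3 := integrable_strongDual_mul (ν := ν) l' l'
  have hV2 : ∫ x, l x * l x ∂ν = V := by simp_rw [hVdef, sq]
  have hB2 : ∫ x, l' x * l' x ∂ν = B := by simp_rw [hBdef, sq]
  have horth : ∫ x, l x * g x ∂ν = 0 := by
    have : ∀ x, l x * g x = l x * l' x - (M / V) * (l x * l x) := fun x => by rw [hgx]; ring
    simp_rw [this]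
    rw [integral_sub i1 (i2.const_mul _), integral_const_mul, hV2]
    field_simp
    simp [hMdef]
  have hτ : ∫ x, g x ^ 2 ∂ν = B - M ^ 2 / V := by
    have : ∀ x, g x ^ 2 = l' x * l' x - (2 * (M / V)) * (l x * l' x) + (M / V) ^ 2 * (l x * l x) :=
      fun x => by rw [hgx]; ring
    simp_rw [this]
    rw [integral_add (f := fun x => l' x * l' x - 2 * (M / V) * (l x * l' x))
      (i3.sub (i1.const_mul _)) (i2.const_mul _), integral_sub i3 (i1.const_mul _),
      integral_const_mul, integral_const_mul, hV2, hB2, ← hMdef]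
    field_simp
    ring
  have hτ0 : 0 ≤ B - M ^ 2 / V := hτ ▸ integral_nonneg fun x => sq_nonneg _
  have hmap := map_prod_strongDual_eq hν horth
  have hVne : (∫ x, l x ^ 2 ∂ν).toNNReal ≠ 0 := by
    rw [← hVdef]; exact (Real.toNNReal_pos.2 hV).ne'
  have key := lintegral_angular_gaussianReal hVne (∫ x, g x ^ 2 ∂ν).toNNReal
  rw [← hmap, Measure.map_prod_map _ _ (by fun_prop) (by fun_prop),
    lintegral_map (by fun_prop) (by fun_prop)] at key
  simp only [Prod.map_fst, Prod.map_snd] at key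
  convert key using 1
  · refine lintegral_congr fun p => ?_
    rw [hgx, hgx]
    ring_nf
  · rw [← hVdef, hτ, Real.coe_toNNReal _ hV.le, Real.coe_toNNReal _ hτ0]
    congr 2
    field_simp

/-- `cos (arctan y) • (p.2 + y • p.1)` is a coordinate of the pair `p` rotated by an angle `± arctan
y`. The measure `ν.prod ν` is rotation invariant, and `H` ignores the factor `cos (arctan y)`. -/
lemma lintegral_eq_lintegral_prod_add_smul (hν : ∫ x, x ∂ν = 0) {H : E → ℝ≥0∞}
    (hH : Measurable H) (hscale : ∀ (c : ℝ) x, c ≠ 0 → H (c • x) = H x) (y : ℝ) :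
    ∫⁻ x, H x ∂ν = ∫⁻ p, H (p.2 + y • p.1) ∂(ν.prod ν) := by
  have hrot := IsGaussian.map_rotation_eq_self (μ := ν) hν (-Real.arctan y)
  have h1 : ∫⁻ x, H x ∂ν = ∫⁻ p, H p.2 ∂(ν.prod ν) := by
    rw [← (measurePreserving_snd (μ := ν) (ν := ν)).lintegral_comp hH]
  rw [h1]
  conv_lhs => rw [← hrot]
  rw [lintegral_map (by fun_prop) (by fun_prop)]
  refine lintegral_congr fun p => ?_
  rw [← hscale _ (p.2 + y • p.1) (Real.cos_arctan_pos y).ne']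
  congr 1
  rw [ContinuousLinearMap.rotation_apply]
  simp only [Real.sin_neg, neg_neg, Real.cos_neg, smul_add, smul_smul]
  rw [← Real.tan_mul_cos (Real.cos_arctan_pos y).ne', Real.tan_arctan, mul_comm y, add_comm]

lemma ae_strongDual_ne_zero (hν : ∫ x, x ∂ν = 0) (l : StrongDual ℝ E)
    (hV : 0 < ∫ x, l x ^ 2 ∂ν) : ∀ᵐ x ∂ν, l x ≠ 0 := by
  have hVne : (∫ x, l x ^ 2 ∂ν).toNNReal ≠ 0 := (Real.toNNReal_pos.2 hV).ne'
  have := nullSingletonClass_gaussianReal (μ := 0) hVne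
  have h0 : (ν.map l) {0} = 0 := by
    rw [map_strongDual_eq_gaussianReal hν l]
    exact measure_singleton 0
  rw [Measure.map_apply (by fun_prop) (measurableSet_singleton 0)] at h0
  exact compl_mem_ae_iff.2 h0

end Gaussian

/-- The Cauchy density. -/
noncomputable def cauchyDensity (y : ℝ) : ℝ≥0∞ := ENNReal.ofReal (Real.pi⁻¹ * (1 + y ^ 2)⁻¹)

lemma measurable_cauchyDensity : Measurable cauchyDensity := by
  unfold cauchyDensity
  fun_prop

lemma lintegral_cauchyDensity : ∫⁻ y, cauchyDensity y = 1 := by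
  unfold cauchyDensity
  rw [← ofReal_integral_eq_lintegral_ofReal (integrable_inv_one_add_sq.const_mul _)
    (Eventually.of_forall fun x => by positivity), integral_const_mul,
    integral_univ_inv_one_add_sq, inv_mul_cancel₀ Real.pi_pos.ne', ENNReal.ofReal_one]

/-- The number of zeros of `f + y h`, averaged over a Cauchy variable `y`, is the angular variation
of the planar curve `(h, f)` divided by `π`. -/
lemma lintegral_numZeros_mul_cauchyDensity {f f' h h' : ℝ → ℝ} {S : Set ℝ} (hS : MeasurableSet S)
    (hf : ∀ t, HasDerivAt f (f' t) t) (hh : ∀ t, HasDerivAt h (h' t) t) (hf' : Continuous f')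
    (hh' : Continuous h') (hcount : {t | t ∈ S ∧ h t = 0}.Countable)
    (hcommon : ∀ t ∈ S, h t = 0 → f t ≠ 0) :
    ∫⁻ y, numZeros (fun t => f t + y * h t) S * cauchyDensity y =
      ∫⁻ t in S, ENNReal.ofReal (Real.pi⁻¹ *
        (|h t * f' t - h' t * f t| / (h t ^ 2 + f t ^ 2))) := by
  have hfc : Continuous f := continuous_iff_continuousAt.2 fun t => (hf t).continuousAt
  have hhc : Continuous h := continuous_iff_continuousAt.2 fun t => (hh t).continuousAt
  set U := {t | h t ≠ 0} with hU
  have hUo : IsOpen U := isOpen_ne_fun hhc continuous_const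
  have hder : ∀ t ∈ U, HasDerivAt (fun t => -f t / h t)
      ((-f' t * h t - -f t * h' t) / h t ^ 2) t := fun t ht => (hf t).neg.div (hh t) ht
  have area := lintegral_encard_fiber_mul hUo hder
    (by
      refine ContinuousOn.div (by fun_prop) (by fun_prop) fun t ht => pow_ne_zero 2 ht)
    (hS.inter hUo.measurableSet) Set.inter_subset_right measurable_cauchyDensity
  -- Off the zeros of `h`, the sum vanishes exactly when `-f / h = y`; at a zero of `h` it cannot
  -- vanish, as `f` and `h` have no common zero.
  have hN : ∀ y, numZeros (fun t => f t + y * h t) S =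
      ({t | t ∈ S ∩ U ∧ -f t / h t = y}.encard : ℝ≥0∞) := by
    intro y
    unfold numZeros
    congr 2
    ext t
    simp only [Set.mem_ofPred_eq, Set.mem_inter_iff, hU]
    constructor
    · rintro ⟨htS, h0⟩
      have hne : h t ≠ 0 := by
        intro hz
        apply hcommon t htS hz
        simpa [hz] using h0
      refine ⟨⟨htS, hne⟩, ?_⟩
      rw [div_eq_iff hne]
      linarith
    · rintro ⟨⟨htS, hne⟩, h0⟩
      refine ⟨htS, ?_⟩
      rw [div_eq_iff hne] at h0
      linarith
  simp_rw [hN]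
  rw [area]
  have hSU : (S ∩ U : Set ℝ) =ᵐ[volume] S := by
    have h0 : ∀ᵐ t, t ∉ {t | t ∈ S ∧ h t = 0} := compl_mem_ae_iff.2 (hcount.measure_zero volume)
    rw [Filter.eventuallyEq_set]
    filter_upwards [h0] with t ht
    exact ⟨fun h => h.1, fun htS => ⟨htS, fun hz => ht ⟨htS, hz⟩⟩⟩
  rw [setLIntegral_congr_fun (hS.inter hUo.measurableSet) (g := fun t => ENNReal.ofReal (Real.pi⁻¹ *
        (|h t * f' t - h' t * f t| / (h t ^ 2 + f t ^ 2)))), setLIntegral_congr hSU]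
  rintro t ⟨-, ht⟩
  have ht' : h t ≠ 0 := ht
  have hpos : 0 < h t ^ 2 + f t ^ 2 := by positivity
  -- The Cauchy density at `-f / h` is `π⁻¹ h² / (h² + f²)`, which absorbs the `h²` in the
  -- denominator of the derivative of the quotient.
  simp only [cauchyDensity]
  rw [← ENNReal.ofReal_mul (abs_nonneg _)]
  congr 1
  rw [abs_div, abs_of_pos (show 0 < h t ^ 2 by positivity), ← abs_neg (h t * f' t - h' t * f t)]
  have : -(h t * f' t - h' t * f t) = -f' t * h t - -f t * h' t := by ring
  rw [this]
  field_simp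

/-- The **Kac–Rice formula** for the expected number of zeros of a centered Gaussian process with
finite-dimensional or Banach-valued coefficients. -/
theorem lintegral_numZeros_eq {E : Type*} [NormedAddCommGroup E] [NormedSpace ℝ E]
    [MeasurableSpace E] [BorelSpace E] [SecondCountableTopology E] [CompleteSpace E]
    {ν : Measure E} [IsGaussian ν] (hν : ∫ x, x ∂ν = 0) {L L' : ℝ → StrongDual ℝ E}
    (hL : ∀ x t, HasDerivAt (fun t => L t x) (L' t x) t)
    (hLc : Continuous fun q : E × ℝ => L q.2 q.1) (hLc' : Continuous fun q : E × ℝ => L' q.2 q.1)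
    (hV : ∀ t, 0 < ∫ x, L t x ^ 2 ∂ν) (a b : ℝ)
    (hcount : ∀ᵐ x ∂ν, {t | t ∈ Set.Icc a b ∧ L t x = 0}.Countable) :
    ∫⁻ x, numZeros (fun t => L t x) (Set.Icc a b) ∂ν = ∫⁻ t in Set.Icc a b, ENNReal.ofReal
      (Real.pi⁻¹ * √(((∫ x, L t x ^ 2 ∂ν) * (∫ x, L' t x ^ 2 ∂ν) - (∫ x, L t x * L' t x ∂ν) ^ 2) /
        (∫ x, L t x ^ 2 ∂ν) ^ 2)) := by
  set S := Set.Icc a b with hS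
  set H : E → ℝ≥0∞ := fun x => numZeros (fun t => L t x) S with hH
  have hHm : Measurable H := measurable_numZeros (F := fun x t => L t x) hLc a b
  have hscale : ∀ (c : ℝ) x, c ≠ 0 → H (c • x) = H x := by
    intro c x hc
    simp [hH, numZeros, hc]
  -- Almost surely the first copy has countably many zeros, and the second copy is almost surely
  -- nonzero at each of them. Writing common zeros as zeros of a sum of squares makes the event
  -- measurable, as Fubini requires.
  have hcommon : ∀ᵐ p ∂(ν.prod ν), ∀ t ∈ S, L t p.1 = 0 → L t p.2 ≠ 0 := by
    have hm : MeasurableSet {p : E × E | ∃ t ∈ S, L t p.1 ^ 2 + L t p.2 ^ 2 = 0} := by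
      refine measurableSet_exists_zero (F := fun (p : E × E) t => L t p.1 ^ 2 + L t p.2 ^ 2) ?_
        isCompact_Icc
      have h1 : Continuous fun q : (E × E) × ℝ => L q.2 q.1.1 :=
        hLc.comp (by fun_prop : Continuous fun q : (E × E) × ℝ => (q.1.1, q.2))
      have h2 : Continuous fun q : (E × E) × ℝ => L q.2 q.1.2 :=
        hLc.comp (by fun_prop : Continuous fun q : (E × E) × ℝ => (q.1.2, q.2))
      exact (h1.pow 2).add (h2.pow 2)
    have h0 : (ν.prod ν) {p : E × E | ∃ t ∈ S, L t p.1 ^ 2 + L t p.2 ^ 2 = 0} = 0 := by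
      rw [Measure.measure_prod_null hm]
      filter_upwards [hcount] with x hx
      have := (ae_ball_iff hx).2 fun t _ => ae_strongDual_ne_zero hν (L t) (hV t)
      refine measure_mono_null ?_ this
      rintro z ⟨t, htS, h0⟩
      have h1 : L t x = 0 := by nlinarith [sq_nonneg (L t x), sq_nonneg (L t z)]
      have h2 : L t z = 0 := by nlinarith [sq_nonneg (L t x), sq_nonneg (L t z)]
      intro hz
      exact hz t ⟨htS, h1⟩ h2
    filter_upwards [compl_mem_ae_iff.2 h0] with p hp t htS h1 h2
    exact hp ⟨t, htS, by simp [h1, h2]⟩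
  have hcount' : ∀ᵐ p ∂(ν.prod ν), {t | t ∈ S ∧ L t p.1 = 0}.Countable :=
    (measurePreserving_fst (μ := ν) (ν := ν)).quasiMeasurePreserving.ae hcount
  have hcont' : ∀ x, Continuous fun t => L' t x := fun x =>
    hLc'.comp (by fun_prop : Continuous fun t : ℝ => (x, t))
  -- The mean of `H (p.2 + y • p.1)` does not depend on `y`, so averaging over a Cauchy variable is
  -- free. After Tonelli, `p.1` plays the role of `h` and `p.2` that of `f`.
  calc ∫⁻ x, H x ∂ν = ∫⁻ y, (∫⁻ x, H x ∂ν) * cauchyDensity y := by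
        rw [lintegral_const_mul _ measurable_cauchyDensity, lintegral_cauchyDensity, mul_one]
    _ = ∫⁻ y, ∫⁻ p, H (p.2 + y • p.1) * cauchyDensity y ∂(ν.prod ν) := by
        refine lintegral_congr fun y => ?_
        rw [lintegral_eq_lintegral_prod_add_smul hν hHm hscale y, lintegral_mul_const]
        exact hHm.comp (by fun_prop)
    _ = ∫⁻ p, (∫⁻ y, H (p.2 + y • p.1) * cauchyDensity y) ∂(ν.prod ν) := by
        refine lintegral_lintegral_swap (Measurable.aemeasurable ?_)
        refine Measurable.mul (hHm.comp ?_) (measurable_cauchyDensity.comp measurable_fst)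
        exact Continuous.measurable (by fun_prop :
          Continuous fun q : ℝ × E × E => q.2.2 + q.1 • q.2.1)
    _ = ∫⁻ p, (∫⁻ t in S, ENNReal.ofReal (Real.pi⁻¹ *
          (|L t p.1 * L' t p.2 - L' t p.1 * L t p.2| / (L t p.1 ^ 2 + L t p.2 ^ 2)))) ∂(ν.prod ν) := by
        refine lintegral_congr_ae ?_
        filter_upwards [hcommon, hcount'] with p hp1 hp2
        rw [← lintegral_numZeros_mul_cauchyDensity measurableSet_Icc (hL p.2) (hL p.1)
          (hcont' _) (hcont' _) hp2 hp1]
        simp [hH, hS]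
    _ = ∫⁻ t in S, ∫⁻ p, ENNReal.ofReal (Real.pi⁻¹ *
          (|L t p.1 * L' t p.2 - L' t p.1 * L t p.2| / (L t p.1 ^ 2 + L t p.2 ^ 2))) ∂(ν.prod ν) := by
        refine lintegral_lintegral_swap (Measurable.aemeasurable ?_)
        have h1 : Measurable fun q : (E × E) × ℝ => L q.2 q.1.1 :=
          hLc.measurable.comp (by fun_prop : Measurable fun q : (E × E) × ℝ => (q.1.1, q.2))
        have h2 : Measurable fun q : (E × E) × ℝ => L q.2 q.1.2 :=
          hLc.measurable.comp (by fun_prop : Measurable fun q : (E × E) × ℝ => (q.1.2, q.2))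
        have h3 : Measurable fun q : (E × E) × ℝ => L' q.2 q.1.1 :=
          hLc'.measurable.comp (by fun_prop : Measurable fun q : (E × E) × ℝ => (q.1.1, q.2))
        have h4 : Measurable fun q : (E × E) × ℝ => L' q.2 q.1.2 :=
          hLc'.measurable.comp (by fun_prop : Measurable fun q : (E × E) × ℝ => (q.1.2, q.2))
        exact ((((h1.mul h4).sub (h3.mul h2)).abs.div
          ((h1.pow_const 2).add (h2.pow_const 2))).const_mul _).ennreal_ofReal
    _ = _ := by
        refine lintegral_congr fun t => ?_
        simp_rw [ENNReal.ofReal_mul (inv_nonneg.2 Real.pi_pos.le)]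
        rw [lintegral_const_mul _ (by fun_prop), lintegral_angular hν (L t) (L' t) (hV t)]

end RandomTrig

/-! ### The random trigonometric polynomial as a Gaussian vector -/

namespace RandomTrig

open scoped NNReal

variable {Ω : Type*} [MeasurableSpace Ω]

/-- Infinitely many zeros in a compact interval would accumulate, and the identity theorem would
force `f = 0`. -/
lemma countable_zeros_Icc_of_analytic {f : ℝ → ℝ} (hf : AnalyticOnNhd ℝ f Set.univ) {t₀ : ℝ}
    (h0 : f t₀ ≠ 0) (p q : ℝ) : {t | t ∈ Set.Icc p q ∧ f t = 0}.Countable := by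
  apply Set.Finite.countable
  by_contra hinf
  obtain ⟨z, -, hz⟩ := Set.Infinite.exists_accPt_of_subset_isCompact hinf
    (isCompact_Icc (a := p) (b := q)) (fun t ht => ht.1)
  have hfreq : ∃ᶠ t in 𝓝[≠] z, f t = 0 := (accPt_iff_frequently_nhdsNE.1 hz).mono fun t ht => ht.2
  exact h0 (hf.eqOn_zero_of_preconnected_of_frequently_eq_zero isPreconnected_univ
    (Set.mem_univ z) hfreq (Set.mem_univ t₀))

/-- The linear functional `x ↦ ∑ⱼ (u j * x.1 j + v j * x.2 j)`. -/
noncomputable def pairFunctional {n : ℕ} (u v : Fin n → ℝ) :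
    StrongDual ℝ ((Fin n → ℝ) × (Fin n → ℝ)) :=
  ∑ j, (u j • (ContinuousLinearMap.proj j ∘L ContinuousLinearMap.fst ℝ _ _) +
    v j • (ContinuousLinearMap.proj j ∘L ContinuousLinearMap.snd ℝ _ _))

lemma pairFunctional_apply {n : ℕ} (u v : Fin n → ℝ) (x : (Fin n → ℝ) × (Fin n → ℝ)) :
    pairFunctional u v x = ∑ j, (u j * x.1 j + v j * x.2 j) := by
  simp [pairFunctional]

/-- Evaluation at `t` of the trigonometric polynomial with given coefficients. -/
noncomputable def evalFunctional (n : ℕ) (t : ℝ) : StrongDual ℝ ((Fin n → ℝ) × (Fin n → ℝ)) :=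
  pairFunctional (fun j => Real.cos (((j : ℕ) + 1 : ℝ) * t))
    (fun j => Real.sin (((j : ℕ) + 1 : ℝ) * t))

/-- Evaluation at `t` of the derivative of the trigonometric polynomial with given coefficients. -/
noncomputable def derivFunctional (n : ℕ) (t : ℝ) : StrongDual ℝ ((Fin n → ℝ) × (Fin n → ℝ)) :=
  pairFunctional (fun j => -((j : ℕ) + 1 : ℝ) * Real.sin (((j : ℕ) + 1 : ℝ) * t))
    (fun j => ((j : ℕ) + 1 : ℝ) * Real.cos (((j : ℕ) + 1 : ℝ) * t))

lemma hasDerivAt_evalFunctional (n : ℕ) (x : (Fin n → ℝ) × (Fin n → ℝ)) (t : ℝ) :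
    HasDerivAt (fun t => evalFunctional n t x) (derivFunctional n t x) t := by
  simp only [evalFunctional, derivFunctional, pairFunctional_apply]
  refine HasDerivAt.fun_sum fun j _ => ?_
  have h0 : HasDerivAt (fun t : ℝ => ((j : ℕ) + 1 : ℝ) * t) ((j : ℕ) + 1 : ℝ) t := by
    simpa using (hasDerivAt_id t).const_mul ((j : ℕ) + 1 : ℝ)
  refine ((h0.cos.mul_const (x.1 j)).add (h0.sin.mul_const (x.2 j))).congr_deriv ?_
  ring

lemma continuous_evalFunctional (n : ℕ) :
    Continuous fun q : ((Fin n → ℝ) × (Fin n → ℝ)) × ℝ => evalFunctional n q.2 q.1 := by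
  simp only [evalFunctional, pairFunctional_apply]
  fun_prop

lemma continuous_derivFunctional (n : ℕ) :
    Continuous fun q : ((Fin n → ℝ) × (Fin n → ℝ)) × ℝ => derivFunctional n q.2 q.1 := by
  simp only [derivFunctional, pairFunctional_apply]
  fun_prop

lemma analyticOnNhd_evalFunctional (n : ℕ) (x : (Fin n → ℝ) × (Fin n → ℝ)) :
    AnalyticOnNhd ℝ (fun t => evalFunctional n t x) Set.univ := by
  intro t _
  simp only [evalFunctional, pairFunctional_apply]
  fun_prop

/-- The vector of the first `n` coefficients of both processes. -/
def coeffVector (a b : ℕ+ → Ω → ℝ) (n : ℕ) (ω : Ω) : (Fin n → ℝ) × (Fin n → ℝ) :=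
  (fun j => a (j : ℕ).succPNat ω, fun j => b (j : ℕ).succPNat ω)

omit [MeasurableSpace Ω] in
lemma trigPoly_eq_evalFunctional (a b : ℕ+ → Ω → ℝ) (n : ℕ) (ω : Ω) (t : ℝ) :
    trigPoly a b n ω t = (1 / √n) * evalFunctional n t (coeffVector a b n ω) := by
  rw [trigPoly, evalFunctional, pairFunctional_apply, Finset.sum_range]
  congr 1
  refine Finset.sum_congr rfl fun j _ => ?_
  simp only [coeffVector]
  ring

variable {P : Measure Ω} {a b : ℕ+ → Ω → ℝ} {ρ : ℕ → ℝ}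

/-- Each half is a Gaussian vector by hypothesis; independence of the halves makes the pair jointly
Gaussian. -/
lemma hasGaussianLaw_coeffVector (ha : IsStationaryGaussian a ρ P) (hb : IsStationaryGaussian b ρ P)
    (hab : IndepFun (fun ω k => a k ω) (fun ω k => b k ω) P) (n : ℕ) :
    HasGaussianLaw (coeffVector a b n) P := by
  have key : ∀ c : ℕ+ → Ω → ℝ, IsGaussianProcess c P →
      HasGaussianLaw (fun ω (j : Fin n) => c (j : ℕ).succPNat ω) P := by
    intro c hc
    have h := hc.comp_right (fun j : Fin n => (j : ℕ).succPNat)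
    have h2 := h.hasGaussianLaw Finset.univ
    exact h2.map (ContinuousLinearMap.pi fun j : Fin n =>
      ContinuousLinearMap.proj (⟨j, Finset.mem_univ j⟩ : (Finset.univ : Finset (Fin n))))
  refine IndepFun.hasGaussianLaw (key a ha.gaussian) (key b hb.gaussian) ?_
  exact hab.comp (φ := fun x (j : Fin n) => x (j : ℕ).succPNat)
    (ψ := fun x (j : Fin n) => x (j : ℕ).succPNat) (by fun_prop) (by fun_prop)

lemma aemeasurable_numZeros_trigPoly (ha : IsStationaryGaussian a ρ P)
    (hb : IsStationaryGaussian b ρ P) (hab : IndepFun (fun ω k => a k ω) (fun ω k => b k ω) P)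
    (n : ℕ) (p q : ℝ) :
    AEMeasurable (fun ω => numZeros (trigPoly a b n ω) (Set.Icc p q)) P := by
  have h1 : Measurable fun x => numZeros (fun t => (1 / √n) * evalFunctional n t x)
      (Set.Icc p q) := measurable_numZeros
        (F := fun x t => (1 / √n) * evalFunctional n t x)
        ((continuous_const (y := 1 / √(n : ℝ))).mul (continuous_evalFunctional n) : Continuous
          fun q : ((Fin n → ℝ) × (Fin n → ℝ)) × ℝ => (1 / √(n : ℝ)) * evalFunctional n q.2 q.1) p q
  have h2 := h1.comp_aemeasurable (hasGaussianLaw_coeffVector ha hb hab n).aemeasurable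
  refine h2.congr (Eventually.of_forall fun ω => ?_)
  simp only [Function.comp_apply]
  congr 1
  ext t
  rw [trigPoly_eq_evalFunctional]

lemma integral_id_map_coeffVector (ha : IsStationaryGaussian a ρ P)
    (hb : IsStationaryGaussian b ρ P) (hab : IndepFun (fun ω k => a k ω) (fun ω k => b k ω) P)
    (n : ℕ) : ∫ x, x ∂(P.map (coeffVector a b n)) = 0 := by
  have h := hasGaussianLaw_coeffVector ha hb hab n
  rw [integral_map h.aemeasurable (by fun_prop)]
  have e : ∀ l : StrongDual ℝ ((Fin n → ℝ) × (Fin n → ℝ)),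
      l (∫ ω, coeffVector a b n ω ∂P) = ∫ ω, l (coeffVector a b n ω) ∂P :=
    fun l => (l.integral_comp_comm h.integrable).symm
  ext j
  · have := e (ContinuousLinearMap.proj j ∘L ContinuousLinearMap.fst ℝ _ _)
    simp only [ContinuousLinearMap.comp_apply, ContinuousLinearMap.proj_apply,
      ContinuousLinearMap.coe_fst'] at this
    exact this.trans (ha.centered _)
  · have := e (ContinuousLinearMap.proj j ∘L ContinuousLinearMap.snd ℝ _ _)
    simp only [ContinuousLinearMap.comp_apply, ContinuousLinearMap.proj_apply,
      ContinuousLinearMap.coe_snd'] at this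
    exact this.trans (hb.centered _)

/-- Covariances of linear functionals of the coefficients. -/
lemma integral_pairFunctional_mul (ha : IsStationaryGaussian a ρ P)
    (hb : IsStationaryGaussian b ρ P) (hab : IndepFun (fun ω k => a k ω) (fun ω k => b k ω) P)
    {n : ℕ} (u v u' v' : Fin n → ℝ) :
    ∫ x, pairFunctional u v x * pairFunctional u' v' x ∂(P.map (coeffVector a b n)) =
      ∑ k : Fin n, ∑ l : Fin n,
        (u k * u' l + v k * v' l) * ρ (((k : ℕ) : ℤ) - ((l : ℕ) : ℤ)).natAbs := by
  have h := hasGaussianLaw_coeffVector ha hb hab n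
  have m2 : ∀ c : ℕ+ → Ω → ℝ, IsStationaryGaussian c ρ P → ∀ k, MemLp (c k) 2 P := fun c hc k =>
    (hc.gaussian.hasGaussianLaw_eval k).memLp_two
  have cross : ∀ k l, ∫ ω, a k ω * b l ω ∂P = 0 := by
    intro k l
    have hind : IndepFun (a k) (b l) P :=
      hab.comp (φ := fun x : ℕ+ → ℝ => x k) (ψ := fun x : ℕ+ → ℝ => x l) (by fun_prop) (by fun_prop)
    have := hind.integral_fun_mul_eq_mul_integral (m2 a ha k).aestronglyMeasurable
      (m2 b hb l).aestronglyMeasurable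
    rw [this, ha.centered, zero_mul]
  have corr : ∀ c : ℕ+ → Ω → ℝ, IsStationaryGaussian c ρ P → ∀ k l : Fin n,
      ∫ ω, c (k : ℕ).succPNat ω * c (l : ℕ).succPNat ω ∂P =
        ρ (((k : ℕ) : ℤ) - ((l : ℕ) : ℤ)).natAbs := by
    intro c hc k l
    rw [hc.correlation]
    congr 2
    simp
  rw [integral_map h.aemeasurable (by fun_prop)]
  simp_rw [pairFunctional_apply, Finset.sum_mul_sum]
  have iaa : ∀ k l, Integrable (fun ω => a k ω * a l ω) P := fun k l =>
    (m2 a ha k).integrable_mul (m2 a ha l)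
  have iab : ∀ k l, Integrable (fun ω => a k ω * b l ω) P := fun k l =>
    (m2 a ha k).integrable_mul (m2 b hb l)
  have ibb : ∀ k l, Integrable (fun ω => b k ω * b l ω) P := fun k l =>
    (m2 b hb k).integrable_mul (m2 b hb l)
  have expand : ∀ (k l : Fin n) ω, (u k * (coeffVector a b n ω).1 k + v k * (coeffVector a b n ω).2 k) *
      (u' l * (coeffVector a b n ω).1 l + v' l * (coeffVector a b n ω).2 l) =
      u k * u' l * (a (k : ℕ).succPNat ω * a (l : ℕ).succPNat ω) +
      u k * v' l * (a (k : ℕ).succPNat ω * b (l : ℕ).succPNat ω) +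
      v k * u' l * (a (l : ℕ).succPNat ω * b (k : ℕ).succPNat ω) +
      v k * v' l * (b (k : ℕ).succPNat ω * b (l : ℕ).succPNat ω) := by
    intro k l ω
    simp only [coeffVector]
    ring
  simp_rw [expand]
  have i1 : ∀ k l : Fin n, Integrable (fun ω =>
      u k * u' l * (a (k : ℕ).succPNat ω * a (l : ℕ).succPNat ω)) P :=
    fun k l => (iaa _ _).const_mul _
  have i2 : ∀ k l : Fin n, Integrable (fun ω =>
      u k * v' l * (a (k : ℕ).succPNat ω * b (l : ℕ).succPNat ω)) P :=
    fun k l => (iab _ _).const_mul _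
  have i3 : ∀ k l : Fin n, Integrable (fun ω =>
      v k * u' l * (a (l : ℕ).succPNat ω * b (k : ℕ).succPNat ω)) P :=
    fun k l => (iab _ _).const_mul _
  have i4 : ∀ k l : Fin n, Integrable (fun ω =>
      v k * v' l * (b (k : ℕ).succPNat ω * b (l : ℕ).succPNat ω)) P :=
    fun k l => (ibb _ _).const_mul _
  have i : ∀ k l : Fin n, Integrable (fun ω =>
      u k * u' l * (a (k : ℕ).succPNat ω * a (l : ℕ).succPNat ω) +
      u k * v' l * (a (k : ℕ).succPNat ω * b (l : ℕ).succPNat ω) +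
      v k * u' l * (a (l : ℕ).succPNat ω * b (k : ℕ).succPNat ω) +
      v k * v' l * (b (k : ℕ).succPNat ω * b (l : ℕ).succPNat ω)) P := fun k l =>
    (((i1 k l).add (i2 k l)).add (i3 k l)).add (i4 k l)
  rw [integral_finsetSum _ fun k _ => integrable_finsetSum _ fun l _ => i k l]
  refine Finset.sum_congr rfl fun k _ => ?_
  rw [integral_finsetSum _ fun l _ => i k l]
  refine Finset.sum_congr rfl fun l _ => ?_
  have e1 := integral_add ((i1 k l).add (i2 k l)) (i3 k l)
  have e2 := integral_add (((i1 k l).add (i2 k l)).add (i3 k l)) (i4 k l)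
  have e3 := integral_add (i1 k l) (i2 k l)
  simp only [Pi.add_apply] at e1 e2 e3
  rw [e2, e1, e3]
  simp_rw [integral_const_mul, cross, corr a ha, corr b hb]
  ring

/-- The expected number of zeros by the Kac–Rice formula, in terms of the variance of the polynomial,
the variance of its derivative, and their covariance. -/
lemma lintegral_numZeros_trigPoly [IsProbabilityMeasure P] (ha : IsStationaryGaussian a ρ P)
    (hb : IsStationaryGaussian b ρ P) (hab : IndepFun (fun ω k => a k ω) (fun ω k => b k ω) P)
    {n : ℕ} (hn : n ≠ 0) {V M B : ℝ → ℝ} (p q : ℝ)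
    (hV : ∀ t, ∫ x, evalFunctional n t x * evalFunctional n t x ∂(P.map (coeffVector a b n)) = V t)
    (hM : ∀ t, ∫ x, evalFunctional n t x * derivFunctional n t x ∂(P.map (coeffVector a b n)) = M t)
    (hB : ∀ t, ∫ x, derivFunctional n t x * derivFunctional n t x ∂(P.map (coeffVector a b n)) = B t)
    (hVpos : ∀ t, 0 < V t) :
    ∫⁻ ω, numZeros (trigPoly a b n ω) (Set.Icc p q) ∂P = ∫⁻ t in Set.Icc p q,
      ENNReal.ofReal (Real.pi⁻¹ * √((V t * B t - M t ^ 2) / V t ^ 2)) := by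
  have h := hasGaussianLaw_coeffVector ha hb hab n
  have hG := h.isGaussian_map
  have hν := integral_id_map_coeffVector ha hb hab n
  have hpos : ∀ t, 0 < ∫ x, evalFunctional n t x ^ 2 ∂(P.map (coeffVector a b n)) := by
    intro t
    simp_rw [sq, hV]
    exact hVpos t
  have kr := lintegral_numZeros_eq hν (hasDerivAt_evalFunctional n) (continuous_evalFunctional n)
    (continuous_derivFunctional n) hpos p q (by
      -- The value at `0` is a nondegenerate Gaussian, so almost surely the polynomial is not
      -- identically zero.
      filter_upwards [ae_strongDual_ne_zero hν (evalFunctional n 0) (hpos 0)] with x hx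
      exact countable_zeros_Icc_of_analytic (analyticOnNhd_evalFunctional n x) hx p q)
  simp_rw [sq (evalFunctional n _ _), sq (derivFunctional n _ _), hV, hM, hB] at kr
  rw [← kr, lintegral_map' (measurable_numZeros (F := fun x t => evalFunctional n t x)
    (continuous_evalFunctional n) p q).aemeasurable h.aemeasurable]
  refine lintegral_congr fun ω => ?_
  unfold numZeros
  -- The normalization does not move zeros, provided `n ≠ 0`: by convention `1 / √0 = 0`.
  have : (1 / √(n : ℝ)) ≠ 0 := by positivity
  simp only [trigPoly_eq_evalFunctional, mul_eq_zero, this, false_or]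

end RandomTrig

/-! ### Trigonometric kernels and their bounds -/

namespace RandomTrig

open scoped NNReal

/-- The kernel `∑ₖ ∑ₗ pₖ qₗ cos ((k - l) x)`. -/
noncomputable def cosKernel {n : ℕ} (p q : Fin n → ℝ) (x : ℝ) : ℝ :=
  ∑ k, ∑ l, p k * q l * Real.cos ((((k : ℕ) : ℤ) - ((l : ℕ) : ℤ) : ℤ) * x)

/-- The kernel `∑ₖ ∑ₗ pₖ qₗ sin ((k - l) x)`. -/
noncomputable def sinKernel {n : ℕ} (p q : Fin n → ℝ) (x : ℝ) : ℝ :=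
  ∑ k, ∑ l, p k * q l * Real.sin ((((k : ℕ) : ℤ) - ((l : ℕ) : ℤ) : ℤ) * x)

/-- The exponential sum `∑ₖ pₖ exp (i (k + 1) x)`. -/
noncomputable def expSum {n : ℕ} (p : Fin n → ℝ) (x : ℝ) : ℂ :=
  ∑ k, (p k : ℂ) * Complex.exp (((((k : ℕ) + 1 : ℝ) * x : ℝ) : ℂ) * Complex.I)

lemma continuous_cosKernel {n : ℕ} (p q : Fin n → ℝ) : Continuous (cosKernel p q) := by
  unfold cosKernel
  fun_prop

lemma continuous_sinKernel {n : ℕ} (p q : Fin n → ℝ) : Continuous (sinKernel p q) := by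
  unfold sinKernel
  fun_prop

/-- This factorization gives the positivity of `cosKernel p p` and reduces all kernel bounds to
bounds on single exponential sums. -/
lemma expSum_mul_conj {n : ℕ} (p q : Fin n → ℝ) (x : ℝ) :
    expSum p x * (starRingEnd ℂ) (expSum q x) = ⟨cosKernel p q x, sinKernel p q x⟩ := by
  have h : ∀ k l : Fin n, (p k : ℂ) * Complex.exp (((((k : ℕ) + 1 : ℝ) * x : ℝ) : ℂ) * Complex.I) *
      (starRingEnd ℂ) ((q l : ℂ) * Complex.exp (((((l : ℕ) + 1 : ℝ) * x : ℝ) : ℂ) * Complex.I)) =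
      ⟨p k * q l * Real.cos ((((k : ℕ) : ℤ) - ((l : ℕ) : ℤ) : ℤ) * x),
        p k * q l * Real.sin ((((k : ℕ) : ℤ) - ((l : ℕ) : ℤ) : ℤ) * x)⟩ := by
    intro k l
    have e : (((((k : ℕ) : ℤ) - ((l : ℕ) : ℤ) : ℤ) : ℝ) * x) =
        ((k : ℕ) + 1 : ℝ) * x - ((l : ℕ) + 1 : ℝ) * x := by push_cast; ring
    rw [e, Real.cos_sub, Real.sin_sub]
    apply Complex.ext
    · simp only [map_mul, Complex.conj_ofReal, Complex.mul_re, Complex.mul_im, Complex.conj_re,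
        Complex.conj_im, Complex.ofReal_re, Complex.ofReal_im, Complex.exp_ofReal_mul_I_re,
        Complex.exp_ofReal_mul_I_im]
      ring
    · simp only [map_mul, Complex.conj_ofReal, Complex.mul_re, Complex.mul_im, Complex.conj_re,
        Complex.conj_im, Complex.ofReal_re, Complex.ofReal_im, Complex.exp_ofReal_mul_I_re,
        Complex.exp_ofReal_mul_I_im]
      ring
  rw [expSum, expSum, map_sum, Finset.sum_mul_sum]
  simp_rw [h]
  apply Complex.ext
  · simp [cosKernel]
  · simp [sinKernel]

lemma cosKernel_self {n : ℕ} (p : Fin n → ℝ) (x : ℝ) : cosKernel p p x = ‖expSum p x‖ ^ 2 := by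
  have h := congrArg Complex.re (expSum_mul_conj p p x)
  rw [Complex.mul_conj, Complex.ofReal_re, Complex.normSq_eq_norm_sq] at h
  exact h.symm

lemma abs_sinKernel_le {n : ℕ} (p q : Fin n → ℝ) (x : ℝ) :
    |sinKernel p q x| ≤ ‖expSum p x‖ * ‖expSum q x‖ := by
  have h := congrArg Complex.im (expSum_mul_conj p q x)
  calc |sinKernel p q x| = |(expSum p x * (starRingEnd ℂ) (expSum q x)).im| := by rw [h]
    _ ≤ ‖expSum p x * (starRingEnd ℂ) (expSum q x)‖ := Complex.abs_im_le_norm _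
    _ = _ := by rw [norm_mul, Complex.norm_conj]

lemma normSq_one_sub_exp (x : ℝ) : ‖1 - Complex.exp ((x : ℂ) * Complex.I)‖ ^ 2 =
    2 * (1 - Real.cos x) := by
  rw [← Complex.normSq_eq_norm_sq, Complex.normSq_apply]
  simp only [Complex.sub_re, Complex.sub_im, Complex.one_re, Complex.one_im,
    Complex.exp_ofReal_mul_I_re, Complex.exp_ofReal_mul_I_im]
  nlinarith [Real.sin_sq_add_cos_sq x]

/-- The constant weights. -/
def onesWeight (n : ℕ) : Fin n → ℝ := fun _ => 1

/-- The weights `k + 1`. -/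
def succWeight (n : ℕ) : Fin n → ℝ := fun k => (k : ℕ) + 1

lemma exp_succ_mul (k : ℕ) (x : ℝ) : Complex.exp ((((k + 1 : ℝ) * x : ℝ) : ℂ) * Complex.I) =
    Complex.exp ((x : ℂ) * Complex.I) ^ (k + 1) := by
  rw [← Complex.exp_nat_mul]
  congr 1
  push_cast
  ring

lemma norm_exp_pow (k : ℕ) (x : ℝ) : ‖Complex.exp ((x : ℂ) * Complex.I) ^ k‖ = 1 := by
  rw [norm_pow, Complex.norm_exp_ofReal_mul_I, one_pow]

/-- Geometric sum, kept in product form so that it also holds where `exp (i x) = 1`. -/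
lemma one_sub_mul_expSum_ones (n : ℕ) (x : ℝ) :
    (1 - Complex.exp ((x : ℂ) * Complex.I)) * expSum (onesWeight n) x =
      Complex.exp ((x : ℂ) * Complex.I) - Complex.exp ((x : ℂ) * Complex.I) ^ (n + 1) := by
  simp only [expSum, onesWeight, exp_succ_mul, Complex.ofReal_one, one_mul]
  rw [Fin.sum_univ_eq_sum_range (fun k => Complex.exp ((x : ℂ) * Complex.I) ^ (k + 1)) n]
  induction n with
  | zero => simp
  | succ n ih => rw [Finset.sum_range_succ, mul_add, ih]; ring

/-- Abel summation reduces the weights `k + 1` to constant weights plus a boundary term. -/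
lemma one_sub_mul_expSum_succ (n : ℕ) (x : ℝ) :
    (1 - Complex.exp ((x : ℂ) * Complex.I)) * expSum (succWeight n) x =
      expSum (onesWeight n) x - n * Complex.exp ((x : ℂ) * Complex.I) ^ (n + 1) := by
  simp only [expSum, onesWeight, succWeight, exp_succ_mul, Complex.ofReal_one, one_mul]
  rw [Fin.sum_univ_eq_sum_range (fun k => Complex.exp ((x : ℂ) * Complex.I) ^ (k + 1)) n,
    Fin.sum_univ_eq_sum_range (fun k => (((k + 1 : ℝ)) : ℂ) *
      Complex.exp ((x : ℂ) * Complex.I) ^ (k + 1)) n]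
  induction n with
  | zero => simp
  | succ n ih =>
    rw [Finset.sum_range_succ, Finset.sum_range_succ, mul_add, ih]
    push_cast
    ring

lemma norm_one_sub_mul_expSum_ones_le (n : ℕ) (x : ℝ) :
    ‖1 - Complex.exp ((x : ℂ) * Complex.I)‖ * ‖expSum (onesWeight n) x‖ ≤ 2 := by
  rw [← norm_mul, one_sub_mul_expSum_ones]
  refine (norm_sub_le _ _).trans ?_
  rw [norm_exp_pow, Complex.norm_exp_ofReal_mul_I]
  norm_num

lemma norm_expSum_ones_le (n : ℕ) (x : ℝ) : ‖expSum (onesWeight n) x‖ ≤ n := by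
  refine (norm_sum_le _ _).trans ?_
  simp [onesWeight, -Complex.ofReal_mul, Complex.norm_exp_ofReal_mul_I]

lemma norm_one_sub_mul_expSum_succ_le (n : ℕ) (x : ℝ) :
    ‖1 - Complex.exp ((x : ℂ) * Complex.I)‖ * ‖expSum (succWeight n) x‖ ≤ 2 * n := by
  rw [← norm_mul, one_sub_mul_expSum_succ]
  refine (norm_sub_le _ _).trans ?_
  rw [norm_mul, norm_exp_pow, mul_one, Complex.norm_natCast]
  linarith [norm_expSum_ones_le n x]

/-- As `|1 - exp (i x)|² = 2 (1 - cos x)`, the square of the bound on the exponential sum gives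
decay away from multiples of `2π`. The next two bounds arise in the same way. -/
lemma cosKernel_ones_mul_le (n : ℕ) (x : ℝ) :
    |cosKernel (onesWeight n) (onesWeight n) x| * (1 - Real.cos x) ≤ 2 := by
  rw [cosKernel_self, abs_of_nonneg (by positivity)]
  have h := pow_le_pow_left₀ (by positivity) (norm_one_sub_mul_expSum_ones_le n x) 2
  rw [mul_pow, normSq_one_sub_exp] at h
  linarith

lemma cosKernel_succ_mul_le (n : ℕ) (x : ℝ) :
    |cosKernel (succWeight n) (succWeight n) x| * (1 - Real.cos x) ≤ 2 * n ^ 2 := by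
  rw [cosKernel_self, abs_of_nonneg (by positivity)]
  have h := pow_le_pow_left₀ (by positivity) (norm_one_sub_mul_expSum_succ_le n x) 2
  rw [mul_pow, normSq_one_sub_exp] at h
  linarith

lemma sinKernel_mul_le (n : ℕ) (x : ℝ) :
    |sinKernel (onesWeight n) (succWeight n) x| * (1 - Real.cos x) ≤ 2 * n := by
  have h := mul_le_mul (norm_one_sub_mul_expSum_ones_le n x) (norm_one_sub_mul_expSum_succ_le n x)
    (by positivity) (by positivity)
  have h2 := normSq_one_sub_exp x
  have h3 := abs_sinKernel_le (onesWeight n) (succWeight n) x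
  have h4 : 0 ≤ 1 - Real.cos x := by linarith [Real.cos_le_one x]
  have h5 := mul_le_mul_of_nonneg_right h3 h4
  have h6 : ‖1 - Complex.exp ((x : ℂ) * Complex.I)‖ * ‖expSum (onesWeight n) x‖ *
      (‖1 - Complex.exp ((x : ℂ) * Complex.I)‖ * ‖expSum (succWeight n) x‖) =
      2 * (‖expSum (onesWeight n) x‖ * ‖expSum (succWeight n) x‖ * (1 - Real.cos x)) := by
    calc _ = ‖1 - Complex.exp ((x : ℂ) * Complex.I)‖ ^ 2 *
          (‖expSum (onesWeight n) x‖ * ‖expSum (succWeight n) x‖) := by ring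
      _ = _ := by rw [h2]; ring
  linarith

/-! ### Integrals of the kernels over a period -/

lemma integral_cos_int_mul_sub (m : ℤ) (t : ℝ) :
    ∫ ξ in (0 : ℝ)..2 * Real.pi, Real.cos (m * (ξ - t)) = if m = 0 then 2 * Real.pi else 0 := by
  split_ifs with h
  · simp [h]
  · have hm : (m : ℝ) ≠ 0 := by exact_mod_cast h
    have hd : ∀ ξ ∈ Set.uIcc 0 (2 * Real.pi), HasDerivAt (fun ξ => Real.sin (m * (ξ - t)) / m)
        (Real.cos (m * (ξ - t))) ξ := by
      intro ξ _
      have h0 : HasDerivAt (fun ξ : ℝ => (m : ℝ) * (ξ - t)) m ξ := by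
        simpa using ((hasDerivAt_id ξ).sub_const t).const_mul (m : ℝ)
      refine (h0.sin.div_const (m : ℝ)).congr_deriv ?_
      field_simp
    rw [intervalIntegral.integral_eq_sub_of_hasDerivAt hd
      (Continuous.intervalIntegrable (by fun_prop) _ _)]
    have : (m : ℝ) * (2 * Real.pi - t) = m * (0 - t) + m * (2 * Real.pi) := by ring
    rw [this, Real.sin_add_int_mul_two_pi, sub_self]

lemma integral_sin_int_mul_sub (m : ℤ) (t : ℝ) :
    ∫ ξ in (0 : ℝ)..2 * Real.pi, Real.sin (m * (ξ - t)) = 0 := by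
  rcases eq_or_ne m 0 with rfl | h
  · simp
  · have hm : (m : ℝ) ≠ 0 := by exact_mod_cast h
    have hd : ∀ ξ ∈ Set.uIcc 0 (2 * Real.pi), HasDerivAt (fun ξ => -Real.cos (m * (ξ - t)) / m)
        (Real.sin (m * (ξ - t))) ξ := by
      intro ξ _
      have h0 : HasDerivAt (fun ξ : ℝ => (m : ℝ) * (ξ - t)) m ξ := by
        simpa using ((hasDerivAt_id ξ).sub_const t).const_mul (m : ℝ)
      refine (h0.cos.neg.div_const (m : ℝ)).congr_deriv ?_
      field_simp
    rw [intervalIntegral.integral_eq_sub_of_hasDerivAt hd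
      (Continuous.intervalIntegrable (by fun_prop) _ _)]
    have : (m : ℝ) * (2 * Real.pi - t) = m * (0 - t) + m * (2 * Real.pi) := by ring
    rw [this, Real.cos_add_int_mul_two_pi, sub_self]

/-- By orthogonality only the diagonal survives. The factor `r` lets one computation serve twice:
with `r = 1` for the mass of a kernel, and with `r` given by `ρ` for the integral in `t` of a
covariance. -/
lemma integral_cosKernel_mul_sub {n : ℕ} (p q : Fin n → ℝ) (r : ℤ → ℝ) (t : ℝ) :
    ∫ ξ in (0 : ℝ)..2 * Real.pi, ∑ k, ∑ l, p k * q l *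
      Real.cos ((((k : ℕ) : ℤ) - ((l : ℕ) : ℤ) : ℤ) * (ξ - t)) *
        r (((k : ℕ) : ℤ) - ((l : ℕ) : ℤ)) =
      2 * Real.pi * r 0 * ∑ k, p k * q k := by
  rw [intervalIntegral.integral_finsetSum fun k _ =>
    Continuous.intervalIntegrable (by fun_prop) _ _, Finset.mul_sum]
  refine Finset.sum_congr rfl fun k _ => ?_
  rw [intervalIntegral.integral_finsetSum fun k _ =>
    Continuous.intervalIntegrable (by fun_prop) _ _]
  simp_rw [intervalIntegral.integral_mul_const, intervalIntegral.integral_const_mul,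
    integral_cos_int_mul_sub]
  rw [Finset.sum_eq_single k]
  · simp
    ring
  · intro l _ hl
    have : ((k : ℕ) : ℤ) - ((l : ℕ) : ℤ) ≠ 0 := by
      intro h
      exact hl (Fin.ext (by omega))
    simp [this]
  · simp

lemma integral_cosKernel_sub {n : ℕ} (p q : Fin n → ℝ) (t : ℝ) :
    ∫ ξ in (0 : ℝ)..2 * Real.pi, cosKernel p q (ξ - t) = 2 * Real.pi * ∑ k, p k * q k := by
  have h := integral_cosKernel_mul_sub p q (fun _ => 1) t
  simp only [mul_one] at h
  exact h

lemma integral_sinKernel_sub {n : ℕ} (p q : Fin n → ℝ) (t : ℝ) :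
    ∫ ξ in (0 : ℝ)..2 * Real.pi, sinKernel p q (ξ - t) = 0 := by
  unfold sinKernel
  rw [intervalIntegral.integral_finsetSum fun k _ =>
    Continuous.intervalIntegrable (by fun_prop) _ _]
  refine Finset.sum_eq_zero fun k _ => ?_
  rw [intervalIntegral.integral_finsetSum fun k _ =>
    Continuous.intervalIntegrable (by fun_prop) _ _]
  refine Finset.sum_eq_zero fun l _ => ?_
  rw [intervalIntegral.integral_const_mul, integral_sin_int_mul_sub, mul_zero]

/-! ### Spectral representation of the covariances -/

section Spectral

variable {μ : Measure ℝ} {ρ : ℕ → ℝ}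

/-- The sine integrals vanish because `ρ` is real; no symmetry of the density is assumed. -/
lemma IsSpectralMeasure.integral_cos (hμ : IsSpectralMeasure μ ρ) (k : ℕ) :
    ∫ ξ, Real.cos (k * ξ) ∂μ = ρ k ∧ ∫ ξ, Real.sin (k * ξ) ∂μ = 0 := by
  have := hμ.1
  have hpt : ∀ ξ : ℝ, Complex.exp (Complex.I * (k : ℂ) * (ξ : ℂ)) =
      Complex.exp (((k * ξ : ℝ) : ℂ) * Complex.I) := by
    intro ξ
    congr 1
    push_cast
    ring
  have hint : Integrable (fun ξ : ℝ => Complex.exp (((k * ξ : ℝ) : ℂ) * Complex.I)) μ := by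
    refine (integrable_const (1 : ℝ)).mono' (by fun_prop) (Eventually.of_forall fun ξ => ?_)
    rw [Complex.norm_exp_ofReal_mul_I]
  have h := hμ.2 k
  simp_rw [hpt] at h
  constructor
  · have h1 := integral_re hint
    simp only [RCLike.re_to_complex, Complex.exp_ofReal_mul_I_re] at h1
    rw [h1, ← h, Complex.ofReal_re]
  · have h1 := integral_im hint
    simp only [RCLike.im_to_complex, Complex.exp_ofReal_mul_I_im] at h1
    rw [h1, ← h, Complex.ofReal_im]

lemma IsSpectralMeasure.integral_cos_sub (hμ : IsSpectralMeasure μ ρ) (m : ℤ) (t : ℝ) :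
    ∫ ξ, Real.cos (m * (ξ - t)) ∂μ = Real.cos (m * t) * ρ m.natAbs ∧
      ∫ ξ, Real.sin (m * (ξ - t)) ∂μ = -(Real.sin (m * t) * ρ m.natAbs) := by
  have := hμ.1
  have hic : Integrable (fun ξ : ℝ => Real.cos (m * ξ)) μ := by
    refine (integrable_const (1 : ℝ)).mono' (by fun_prop) (Eventually.of_forall fun ξ => ?_)
    exact Real.abs_cos_le_one _
  have his : Integrable (fun ξ : ℝ => Real.sin (m * ξ)) μ := by
    refine (integrable_const (1 : ℝ)).mono' (by fun_prop) (Eventually.of_forall fun ξ => ?_)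
    exact Real.abs_sin_le_one _
  have hm : ∫ ξ, Real.cos (m * ξ) ∂μ = ρ m.natAbs ∧ ∫ ξ, Real.sin (m * ξ) ∂μ = 0 := by
    have h := hμ.integral_cos m.natAbs
    rcases Int.natAbs_eq m with hm | hm
    · have e : (m : ℝ) = (m.natAbs : ℝ) := by
        conv_lhs => rw [hm]
        simp
      rw [e]
      exact h
    · have e : (m : ℝ) = -(m.natAbs : ℝ) := by
        conv_lhs => rw [hm]
        simp
      rw [e]
      simp only [neg_mul, Real.cos_neg, Real.sin_neg, integral_neg, h.1, h.2, neg_zero, and_self]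
  simp_rw [mul_sub, Real.cos_sub, Real.sin_sub]
  constructor
  · rw [integral_add (hic.mul_const _) (his.mul_const _), integral_mul_const, integral_mul_const,
      hm.1, hm.2]
    ring
  · rw [integral_sub (his.mul_const _) (hic.mul_const _), integral_mul_const, integral_mul_const,
      hm.1, hm.2]
    ring

lemma IsSpectralMeasure.integral_cosKernel (hμ : IsSpectralMeasure μ ρ) {n : ℕ} (p q : Fin n → ℝ)
    (t : ℝ) : ∫ ξ, cosKernel p q (ξ - t) ∂μ = ∑ k, ∑ l, p k * q l *
      Real.cos ((((k : ℕ) : ℤ) - ((l : ℕ) : ℤ) : ℤ) * t) *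
        ρ (((k : ℕ) : ℤ) - ((l : ℕ) : ℤ)).natAbs := by
  have := hμ.1
  have hi : ∀ k l : Fin n, Integrable (fun ξ : ℝ => p k * q l *
      Real.cos ((((k : ℕ) : ℤ) - ((l : ℕ) : ℤ) : ℤ) * (ξ - t))) μ := by
    intro k l
    refine Integrable.const_mul ?_ _
    refine (integrable_const (1 : ℝ)).mono' (by fun_prop) (Eventually.of_forall fun ξ => ?_)
    exact Real.abs_cos_le_one _
  unfold cosKernel
  rw [integral_finsetSum _ fun k _ => integrable_finsetSum _ fun l _ => hi k l]
  refine Finset.sum_congr rfl fun k _ => ?_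
  rw [integral_finsetSum _ fun l _ => hi k l]
  refine Finset.sum_congr rfl fun l _ => ?_
  rw [integral_const_mul, (hμ.integral_cos_sub _ t).1]
  ring

/-- The minus sign compensates the oddness of the sine, the kernel being evaluated at `ξ - t` rather
than `t - ξ`. -/
lemma IsSpectralMeasure.integral_sinKernel (hμ : IsSpectralMeasure μ ρ) {n : ℕ} (p q : Fin n → ℝ)
    (t : ℝ) : ∫ ξ, -sinKernel p q (ξ - t) ∂μ = ∑ k, ∑ l, p k * q l *
      Real.sin ((((k : ℕ) : ℤ) - ((l : ℕ) : ℤ) : ℤ) * t) *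
        ρ (((k : ℕ) : ℤ) - ((l : ℕ) : ℤ)).natAbs := by
  have := hμ.1
  have hi : ∀ k l : Fin n, Integrable (fun ξ : ℝ => p k * q l *
      Real.sin ((((k : ℕ) : ℤ) - ((l : ℕ) : ℤ) : ℤ) * (ξ - t))) μ := by
    intro k l
    refine Integrable.const_mul ?_ _
    refine (integrable_const (1 : ℝ)).mono' (by fun_prop) (Eventually.of_forall fun ξ => ?_)
    exact Real.abs_sin_le_one _
  rw [integral_neg]
  unfold sinKernel
  rw [integral_finsetSum _ fun k _ => integrable_finsetSum _ fun l _ => hi k l,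
    ← Finset.sum_neg_distrib]
  refine Finset.sum_congr rfl fun k _ => ?_
  rw [integral_finsetSum _ fun l _ => hi k l, ← Finset.sum_neg_distrib]
  refine Finset.sum_congr rfl fun l _ => ?_
  rw [integral_const_mul, (hμ.integral_cos_sub _ t).2]
  ring

end Spectral

section Covariances

variable {Ω : Type*} [MeasurableSpace Ω] {P : Measure Ω} {a b : ℕ+ → Ω → ℝ} {ρ : ℕ → ℝ}
  {μ : Measure ℝ}

lemma integral_eval_mul_eval (ha : IsStationaryGaussian a ρ P) (hb : IsStationaryGaussian b ρ P)
    (hab : IndepFun (fun ω k => a k ω) (fun ω k => b k ω) P) (hμ : IsSpectralMeasure μ ρ) (n : ℕ)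
    (t : ℝ) :
    ∫ x, evalFunctional n t x * evalFunctional n t x ∂(P.map (coeffVector a b n)) =
      ∫ ξ, cosKernel (onesWeight n) (onesWeight n) (ξ - t) ∂μ := by
  rw [hμ.integral_cosKernel]
  unfold evalFunctional
  rw [integral_pairFunctional_mul ha hb hab]
  refine Finset.sum_congr rfl fun k _ => Finset.sum_congr rfl fun l _ => ?_
  have e : (((((k : ℕ) : ℤ) - ((l : ℕ) : ℤ) : ℤ) : ℝ) * t) =
      ((k : ℕ) + 1 : ℝ) * t - ((l : ℕ) + 1 : ℝ) * t := by push_cast; ring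
  rw [e, Real.cos_sub]
  simp [onesWeight]

lemma integral_deriv_mul_deriv (ha : IsStationaryGaussian a ρ P) (hb : IsStationaryGaussian b ρ P)
    (hab : IndepFun (fun ω k => a k ω) (fun ω k => b k ω) P) (hμ : IsSpectralMeasure μ ρ) (n : ℕ)
    (t : ℝ) :
    ∫ x, derivFunctional n t x * derivFunctional n t x ∂(P.map (coeffVector a b n)) =
      ∫ ξ, cosKernel (succWeight n) (succWeight n) (ξ - t) ∂μ := by
  rw [hμ.integral_cosKernel]
  unfold derivFunctional
  rw [integral_pairFunctional_mul ha hb hab]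
  refine Finset.sum_congr rfl fun k _ => Finset.sum_congr rfl fun l _ => ?_
  have e : (((((k : ℕ) : ℤ) - ((l : ℕ) : ℤ) : ℤ) : ℝ) * t) =
      ((k : ℕ) + 1 : ℝ) * t - ((l : ℕ) + 1 : ℝ) * t := by push_cast; ring
  rw [e, Real.cos_sub]
  simp only [succWeight]
  ring

lemma integral_eval_mul_deriv (ha : IsStationaryGaussian a ρ P) (hb : IsStationaryGaussian b ρ P)
    (hab : IndepFun (fun ω k => a k ω) (fun ω k => b k ω) P) (hμ : IsSpectralMeasure μ ρ) (n : ℕ)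
    (t : ℝ) :
    ∫ x, evalFunctional n t x * derivFunctional n t x ∂(P.map (coeffVector a b n)) =
      ∫ ξ, -sinKernel (onesWeight n) (succWeight n) (ξ - t) ∂μ := by
  rw [hμ.integral_sinKernel]
  unfold evalFunctional derivFunctional
  rw [integral_pairFunctional_mul ha hb hab]
  refine Finset.sum_congr rfl fun k _ => Finset.sum_congr rfl fun l _ => ?_
  have e : (((((k : ℕ) : ℤ) - ((l : ℕ) : ℤ) : ℤ) : ℝ) * t) =
      ((k : ℕ) + 1 : ℝ) * t - ((l : ℕ) + 1 : ℝ) * t := by push_cast; ring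
  rw [e, Real.sin_sub]
  simp only [succWeight, onesWeight]
  ring

end Covariances

end RandomTrig

namespace RandomTrig

open scoped NNReal

/-! ### Concentrating kernels -/

/-- A sequence of kernels on the circle that converges to `c` times the Dirac mass at `0`. -/
structure IsConcentrating (Q : ℕ → ℝ → ℝ) (c : ℝ) : Prop where
  continuous : ∀ n, Continuous (Q n)
  bounded : ∃ C, ∀ n t, ∫ ξ in (0 : ℝ)..2 * Real.pi, |Q n (ξ - t)| ≤ C
  mass : ∀ t, Tendsto (fun n => ∫ ξ in (0 : ℝ)..2 * Real.pi, Q n (ξ - t)) atTop (𝓝 c)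
  decay : ∃ C : ℝ, ∀ n x, |Q n x| * (1 - Real.cos x) ≤ C / n

/-- Used at the atoms of the spectral measure, whose contribution thus disappears in the limit. -/
lemma IsConcentrating.tendsto_zero {Q : ℕ → ℝ → ℝ} {c : ℝ} (hQ : IsConcentrating Q c) {x : ℝ}
    (hx : Real.cos x ≠ 1) : Tendsto (fun n => Q n x) atTop (𝓝 0) := by
  obtain ⟨C, hC⟩ := hQ.decay
  have hpos : 0 < 1 - Real.cos x := sub_pos.2 (lt_of_le_of_ne (Real.cos_le_one x) hx)
  refine squeeze_zero_norm (a := fun n : ℕ => C / n / (1 - Real.cos x)) (fun n => ?_) ?_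
  · rw [Real.norm_eq_abs, le_div_iff₀ hpos]
    exact hC n x
  · simpa using (tendsto_const_div_atTop_nhds_zero_nat C).div_const (1 - Real.cos x)

/-- For `t` interior, `|ξ - t| < 2π`, so the cosine equals `1` only at `ξ = t`; compactness supplies
a uniform gap. -/
lemma exists_pos_le_one_sub_cos {t δ : ℝ} (ht : t ∈ Set.Ioo 0 (2 * Real.pi)) (hδ : 0 < δ) :
    ∃ κ > 0, ∀ ξ ∈ Set.Icc 0 (2 * Real.pi), δ ≤ |ξ - t| → κ ≤ 1 - Real.cos (ξ - t) := by
  set K := Set.Icc 0 (2 * Real.pi) ∩ {ξ | δ ≤ |ξ - t|} with hK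
  have hKc : IsCompact K :=
    isCompact_Icc.inter_right (isClosed_le continuous_const (by fun_prop))
  rcases K.eq_empty_or_nonempty with h | h
  · refine ⟨1, one_pos, fun ξ h1 h2 => ?_⟩
    exact absurd (show ξ ∈ K from ⟨h1, h2⟩) (by rw [h]; simp)
  · obtain ⟨z, hz, hmin⟩ := hKc.exists_isMinOn h
      (f := fun ξ => 1 - Real.cos (ξ - t)) (by fun_prop)
    refine ⟨1 - Real.cos (z - t), ?_, fun ξ h1 h2 => hmin ⟨h1, h2⟩⟩
    refine sub_pos.2 (lt_of_le_of_ne (Real.cos_le_one _) fun hcos => ?_)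
    have h0 : z - t = 0 := (Real.cos_eq_one_iff_of_lt_of_lt (by linarith [ht.2, hz.1.1])
      (by linarith [ht.1, hz.1.2])).1 hcos
    have h1 : δ ≤ |z - t| := hz.2
    rw [h0, abs_zero] at h1
    linarith

/-- Approximate identity: near `t`, continuity of `φ` meets the uniform `L¹` bound on the kernels;
away from `t`, their decay meets the bound on `φ`. -/
lemma IsConcentrating.tendsto_integral_mul {Q : ℕ → ℝ → ℝ} {c : ℝ} (hQ : IsConcentrating Q c)
    {φ : ℝ → ℝ} {M t : ℝ} (hφm : AEStronglyMeasurable φ (volume.restrict (Set.Ioc 0 (2 * Real.pi))))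
    (hφb : ∀ ξ ∈ Set.Icc 0 (2 * Real.pi), |φ ξ| ≤ M) (ht : t ∈ Set.Ioo 0 (2 * Real.pi))
    (hφc : ContinuousAt φ t) :
    Tendsto (fun n => ∫ ξ in (0 : ℝ)..2 * Real.pi, Q n (ξ - t) * φ ξ) atTop (𝓝 (c * φ t)) := by
  have hpi : (0 : ℝ) ≤ 2 * Real.pi := by positivity
  obtain ⟨C, hC⟩ := hQ.bounded
  obtain ⟨D, hD⟩ := hQ.decay
  have hM0 : 0 ≤ M := (abs_nonneg _).trans (hφb t ⟨ht.1.le, ht.2.le⟩)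
  have hcont : ∀ n, Continuous fun ξ => Q n (ξ - t) := fun n =>
    (hQ.continuous n).comp (by fun_prop)
  have hφi : IntervalIntegrable φ volume 0 (2 * Real.pi) := by
    rw [intervalIntegrable_iff_integrableOn_Ioc_of_le hpi]
    refine (integrable_const M).mono' hφm ?_
    filter_upwards [ae_restrict_mem measurableSet_Ioc] with ξ hξ
    exact hφb ξ ⟨hξ.1.le, hξ.2⟩
  have hprod : ∀ n, IntervalIntegrable (fun ξ => Q n (ξ - t) * φ ξ) volume 0 (2 * Real.pi) :=
    fun n => hφi.continuousOn_mul (hcont n).continuousOn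
  have hdiff : Tendsto (fun n => ∫ ξ in (0 : ℝ)..2 * Real.pi, Q n (ξ - t) * (φ ξ - φ t)) atTop
      (𝓝 0) := by
    rw [Metric.tendsto_atTop]
    intro ε hε
    have hC0 : 0 ≤ C := le_trans
      (intervalIntegral.integral_nonneg hpi fun _ _ => abs_nonneg _) (hC 0 t)
    -- Chosen so that `ε' * (C + 1) = ε / 2`; the `+ 1` covers `C = 0`.
    set ε' := ε / (2 * (C + 1)) with hε'
    have hε'0 : 0 < ε' := by positivity
    obtain ⟨δ, hδ, hδφ⟩ := Metric.continuousAt_iff.1 hφc ε' hε'0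
    obtain ⟨κ, hκ, hκb⟩ := exists_pos_le_one_sub_cos ht hδ
    have hlim : Tendsto (fun n : ℕ => 2 * Real.pi * (2 * M / κ) * (D / n)) atTop (𝓝 0) := by
      simpa using (tendsto_const_div_atTop_nhds_zero_nat D).const_mul (2 * Real.pi * (2 * M / κ))
    obtain ⟨n₀, hn₀⟩ := eventually_atTop.1 (hlim.eventually_lt_const (half_pos hε))
    refine ⟨n₀, fun n hn => ?_⟩
    have hbound : ∀ ξ ∈ Set.Icc 0 (2 * Real.pi), ‖Q n (ξ - t) * (φ ξ - φ t)‖ ≤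
        ε' * |Q n (ξ - t)| + 2 * M / κ * (D / n) := by
      intro ξ hξ
      have hDn : 0 ≤ D / n := le_trans
        (mul_nonneg (abs_nonneg _) (by linarith [Real.cos_le_one (ξ - t)])) (hD n (ξ - t))
      rw [norm_mul, Real.norm_eq_abs, Real.norm_eq_abs]
      rcases lt_or_ge |ξ - t| δ with h | h
      · have h1 : |φ ξ - φ t| < ε' := hδφ (by rwa [Real.dist_eq])
        have h2 : 0 ≤ 2 * M / κ * (D / n) := by positivity
        nlinarith [abs_nonneg (Q n (ξ - t))]
      · have h1 : |φ ξ - φ t| ≤ 2 * M := by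
          have := abs_sub (φ ξ) (φ t)
          linarith [hφb ξ hξ, hφb t ⟨ht.1.le, ht.2.le⟩]
        have h2 : |Q n (ξ - t)| ≤ D / n / κ := by
          rw [le_div_iff₀ hκ]
          exact (mul_le_mul_of_nonneg_left (hκb ξ hξ h) (abs_nonneg _)).trans (hD n (ξ - t))
        have h3 : |Q n (ξ - t)| * |φ ξ - φ t| ≤ D / n / κ * (2 * M) :=
          mul_le_mul h2 h1 (abs_nonneg _) (by positivity)
        have h4 : 0 ≤ ε' * |Q n (ξ - t)| := by positivity
        have h5 : D / n / κ * (2 * M) = 2 * M / κ * (D / n) := by ring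
        linarith
    have hint : IntervalIntegrable (fun ξ => ε' * |Q n (ξ - t)| + 2 * M / κ * (D / n)) volume 0
        (2 * Real.pi) :=
      (((hcont n).abs.const_mul ε').add continuous_const).intervalIntegrable _ _
    rw [dist_zero_right]
    calc ‖∫ ξ in (0 : ℝ)..2 * Real.pi, Q n (ξ - t) * (φ ξ - φ t)‖
        ≤ ∫ ξ in (0 : ℝ)..2 * Real.pi, (ε' * |Q n (ξ - t)| + 2 * M / κ * (D / n)) :=
          intervalIntegral.norm_integral_le_of_norm_le hpi
            (Eventually.of_forall fun ξ hξ => hbound ξ ⟨hξ.1.le, hξ.2⟩) hint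
      _ = ε' * (∫ ξ in (0 : ℝ)..2 * Real.pi, |Q n (ξ - t)|) +
            2 * Real.pi * (2 * M / κ) * (D / n) := by
          rw [intervalIntegral.integral_add (((hcont n).abs.const_mul ε').intervalIntegrable _ _)
            (continuous_const.intervalIntegrable _ _), intervalIntegral.integral_const_mul,
            intervalIntegral.integral_const, smul_eq_mul]
          ring
      _ < ε' * (C + 1) + ε / 2 := by
          have := mul_le_mul_of_nonneg_left (hC n t) hε'0.le
          have := hn₀ n hn
          nlinarith
      _ = ε := by rw [hε']; field_simp; norm_num
  have hmain := hdiff.add ((hQ.mass t).mul_const (φ t))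
  rw [zero_add] at hmain
  refine hmain.congr fun n => ?_
  have hc1 : IntervalIntegrable (fun ξ => Q n (ξ - t)) volume 0 (2 * Real.pi) :=
    (hcont n).intervalIntegrable _ _
  simp_rw [mul_sub]
  rw [intervalIntegral.integral_sub (hprod n) (hc1.mul_const _),
    intervalIntegral.integral_mul_const]
  ring

/-! ### Vitali convergence from a bound on second moments -/

/-- Truncation at height `M` allows dominated convergence, and the part cut off is at most `s² / M`,
hence of integral at most `C / M`. -/
lemma tendsto_integral_of_sq_bounded {X : Type*} [MeasurableSpace X] {κ : Measure X}
    [IsFiniteMeasure κ] {s : ℕ → X → ℝ} {c C : ℝ} (hs0 : ∀ n x, 0 ≤ s n x)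
    (hsm : ∀ n, AEStronglyMeasurable (s n) κ) (hsi : ∀ n, Integrable (fun x => s n x ^ 2) κ)
    (hsC : ∀ᶠ n in atTop, ∫ x, s n x ^ 2 ∂κ ≤ C)
    (hlim : ∀ᵐ x ∂κ, Tendsto (fun n => s n x) atTop (𝓝 c)) :
    Tendsto (fun n => ∫ x, s n x ∂κ) atTop (𝓝 (∫ _, c ∂κ)) := by
  have hint : ∀ n, Integrable (s n) κ := fun n => by
    refine ((integrable_const (1 : ℝ)).add (hsi n)).mono' (hsm n) (Eventually.of_forall fun x => ?_)
    simp only [Pi.add_apply]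
    rw [Real.norm_eq_abs, abs_of_nonneg (hs0 n x)]
    nlinarith [sq_nonneg (s n x - 1), hs0 n x]
  have hC0 : 0 ≤ C := by
    obtain ⟨n, hn⟩ := hsC.exists
    exact (integral_nonneg fun x => sq_nonneg _).trans hn
  rw [Metric.tendsto_atTop']
  intro ε hε
  -- `M ≥ c` leaves the limit untouched, `M ≥ 1` keeps it positive, and `M ≥ 4 C / ε` makes the
  -- truncation error at most `ε / 4`.
  set M : ℝ := max (max c 1) (4 * C / ε) with hM
  have hM1 : 1 ≤ M := (le_max_right _ _).trans (le_max_left _ _)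
  have hMc : c ≤ M := (le_max_left _ _).trans (le_max_left _ _)
  have hMC : C / M ≤ ε / 4 := by
    rw [div_le_iff₀ (by linarith)]
    have h1 : 4 * C / ε ≤ M := le_max_right _ _
    rw [div_le_iff₀ hε] at h1
    linarith
  have hmini : ∀ n, Integrable (fun x => min (s n x) M) κ := fun n =>
    (hint n).inf (integrable_const M)
  have htrunc : Tendsto (fun n => ∫ x, min (s n x) M ∂κ) atTop (𝓝 (∫ _, c ∂κ)) := by
    refine tendsto_integral_of_dominated_convergence (fun _ => M) (fun n => (hmini n).1)
      (integrable_const M) (fun n => Eventually.of_forall fun x => ?_) ?_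
    · rw [Real.norm_eq_abs, abs_of_nonneg (le_min (hs0 n x) (by linarith))]
      exact min_le_right _ _
    · filter_upwards [hlim] with x hx
      have := hx.min (tendsto_const_nhds (x := M))
      rwa [min_eq_left hMc] at this
  have hclose : ∀ᶠ n in atTop, |∫ x, s n x ∂κ - ∫ x, min (s n x) M ∂κ| ≤ ε / 4 := by
    filter_upwards [hsC] with n hn
    rw [← integral_sub (hint n) (hmini n), abs_of_nonneg
      (integral_nonneg fun x => sub_nonneg.2 (min_le_left _ _))]
    refine le_trans (integral_mono ((hint n).sub (hmini n)) ((hsi n).div_const M) fun x => ?_)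
      (?_ : ∫ x, s n x ^ 2 / M ∂κ ≤ ε / 4)
    · beta_reduce
      rw [le_div_iff₀ (by linarith)]
      rcases le_total (s n x) M with h | h
      · rw [min_eq_left h, sub_self, zero_mul]
        positivity
      · rw [min_eq_right h]
        nlinarith
    · rw [integral_div]
      exact (div_le_div_of_nonneg_right hn (by linarith)).trans hMC
  obtain ⟨n₀, hn₀⟩ := eventually_atTop.1 (hclose.and
    ((Metric.tendsto_nhds.1 htrunc) (ε / 2) (by positivity)))
  refine ⟨n₀, fun n hn => ?_⟩
  obtain ⟨h1, h2⟩ := hn₀ n hn.le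
  rw [Real.dist_eq] at h2 ⊢
  have := abs_sub_le (∫ x, s n x ∂κ) (∫ x, min (s n x) M ∂κ) (∫ _, c ∂κ)
  linarith

/-! ### The normalized kernels -/

lemma sum_succWeight_mul_self (n : ℕ) :
    ∑ k, succWeight n k * succWeight n k = n * (n + 1) * (2 * n + 1) / 6 := by
  simp only [succWeight]
  rw [Fin.sum_univ_eq_sum_range (fun k => ((k : ℝ) + 1) * ((k : ℝ) + 1)) n]
  induction n with
  | zero => simp
  | succ n ih =>
    rw [Finset.sum_range_succ, ih]
    push_cast
    ring

lemma sum_succWeight_mul_self_le (n : ℕ) : ∑ k, succWeight n k * succWeight n k ≤ (n : ℝ) ^ 3 := by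
  rw [sum_succWeight_mul_self]
  rcases Nat.eq_zero_or_pos n with rfl | hn
  · simp
  · have : (1 : ℝ) ≤ n := by exact_mod_cast hn
    nlinarith [mul_nonneg (by linarith : (0 : ℝ) ≤ n) (by linarith : (0 : ℝ) ≤ n - 1), sq_nonneg (n : ℝ),
      mul_nonneg (mul_nonneg (by linarith : (0 : ℝ) ≤ n) (by linarith : (0 : ℝ) ≤ n))
        (by linarith : (0 : ℝ) ≤ n - 1)]

lemma sum_onesWeight_mul_self (n : ℕ) : ∑ k, onesWeight n k * onesWeight n k = n := by
  simp [onesWeight]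

lemma cosKernel_self_nonneg {n : ℕ} (p : Fin n → ℝ) (x : ℝ) : 0 ≤ cosKernel p p x := by
  rw [cosKernel_self]
  positivity

/-- The Fejér kernel. -/
noncomputable def valueKernel (n : ℕ) (x : ℝ) : ℝ := cosKernel (onesWeight n) (onesWeight n) x / n

/-- The normalized kernel of the variance of the derivative. -/
noncomputable def derivKernel (n : ℕ) (x : ℝ) : ℝ :=
  cosKernel (succWeight n) (succWeight n) x / n ^ 3

/-- The normalized kernel of the covariance of the value and the derivative. -/
noncomputable def mixedKernel (n : ℕ) (x : ℝ) : ℝ :=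
  -sinKernel (onesWeight n) (succWeight n) x / n ^ 2

lemma continuous_valueKernel (n : ℕ) : Continuous (valueKernel n) :=
  (continuous_cosKernel _ _).div_const _

lemma continuous_derivKernel (n : ℕ) : Continuous (derivKernel n) :=
  (continuous_cosKernel _ _).div_const _

lemma continuous_mixedKernel (n : ℕ) : Continuous (mixedKernel n) :=
  (continuous_sinKernel _ _).neg.div_const _

lemma valueKernel_nonneg (n : ℕ) (x : ℝ) : 0 ≤ valueKernel n x :=
  div_nonneg (cosKernel_self_nonneg _ _) (by positivity)

lemma derivKernel_nonneg (n : ℕ) (x : ℝ) : 0 ≤ derivKernel n x :=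
  div_nonneg (cosKernel_self_nonneg _ _) (by positivity)

/-- The inequality between arithmetic and geometric means, with each exponential sum scaled to its
own size. The mixed kernel has no sign, so its `L¹` bound is borrowed from the two nonnegative
kernels. -/
lemma abs_mixedKernel_le (n : ℕ) (x : ℝ) : |mixedKernel n x| ≤ valueKernel n x + derivKernel n x := by
  rcases Nat.eq_zero_or_pos n with rfl | hn
  · simp [mixedKernel, valueKernel, derivKernel]
  have hn' : (0 : ℝ) < n := by exact_mod_cast hn
  rw [mixedKernel, valueKernel, derivKernel, cosKernel_self, cosKernel_self, abs_div, abs_neg,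
    abs_of_pos (pow_pos hn' 2)]
  have h := abs_sinKernel_le (onesWeight n) (succWeight n) x
  set u := ‖expSum (onesWeight n) x‖
  set v := ‖expSum (succWeight n) x‖
  have e : u ^ 2 / n + v ^ 2 / n ^ 3 - u * v / n ^ 2 =
      ((n * u - v) ^ 2 + n * (u * v)) / n ^ 3 := by
    field_simp
    ring
  have h1 : 0 ≤ ((n * u - v) ^ 2 + n * (u * v)) / n ^ 3 := by positivity
  have h2 : |sinKernel (onesWeight n) (succWeight n) x| / n ^ 2 ≤ u * v / n ^ 2 := by gcongr
  linarith

lemma integral_valueKernel_sub {n : ℕ} (hn : n ≠ 0) (t : ℝ) :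
    ∫ ξ in (0 : ℝ)..2 * Real.pi, valueKernel n (ξ - t) = 2 * Real.pi := by
  have hn' : (n : ℝ) ≠ 0 := by exact_mod_cast hn
  simp only [valueKernel]
  rw [intervalIntegral.integral_div, integral_cosKernel_sub, sum_onesWeight_mul_self]
  field_simp

lemma integral_derivKernel_sub (n : ℕ) (t : ℝ) :
    ∫ ξ in (0 : ℝ)..2 * Real.pi, derivKernel n (ξ - t) =
      2 * Real.pi * (n * (n + 1) * (2 * n + 1) / 6 / n ^ 3) := by
  simp only [derivKernel]
  rw [intervalIntegral.integral_div, integral_cosKernel_sub, sum_succWeight_mul_self, mul_div_assoc]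

lemma integral_valueKernel_sub_le (n : ℕ) (t : ℝ) :
    ∫ ξ in (0 : ℝ)..2 * Real.pi, valueKernel n (ξ - t) ≤ 2 * Real.pi := by
  rcases eq_or_ne n 0 with rfl | hn
  · simp [valueKernel, Real.pi_pos.le]
  · exact (integral_valueKernel_sub hn t).le

lemma integral_derivKernel_sub_le (n : ℕ) (t : ℝ) :
    ∫ ξ in (0 : ℝ)..2 * Real.pi, derivKernel n (ξ - t) ≤ 2 * Real.pi := by
  rw [integral_derivKernel_sub, ← sum_succWeight_mul_self]
  have : (∑ k, succWeight n k * succWeight n k) / (n : ℝ) ^ 3 ≤ 1 :=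
    div_le_one_of_le₀ (sum_succWeight_mul_self_le n) (by positivity)
  nlinarith [Real.pi_pos]

lemma isConcentrating_valueKernel : IsConcentrating valueKernel (2 * Real.pi) where
  continuous := continuous_valueKernel
  bounded := ⟨2 * Real.pi, fun n t => by
    simp_rw [abs_of_nonneg (valueKernel_nonneg n _)]
    exact integral_valueKernel_sub_le n t⟩
  mass t := by
    refine tendsto_const_nhds.congr' ?_
    filter_upwards [eventually_ne_atTop 0] with n hn
    rw [integral_valueKernel_sub hn]
  decay := ⟨2, fun n x => by
    rw [valueKernel, abs_div, Nat.abs_cast, div_mul_eq_mul_div]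
    exact div_le_div_of_nonneg_right (cosKernel_ones_mul_le n x) (by positivity)⟩

/-- The mass comes from `∑ (k + 1)² ~ n³ / 3`, the source of the `√3` in the theorem. -/
lemma isConcentrating_derivKernel : IsConcentrating derivKernel (2 * Real.pi / 3) where
  continuous := continuous_derivKernel
  bounded := ⟨2 * Real.pi, fun n t => by
    simp_rw [abs_of_nonneg (derivKernel_nonneg n _)]
    exact integral_derivKernel_sub_le n t⟩
  mass t := by
    simp_rw [integral_derivKernel_sub]
    have h1 : Tendsto (fun n : ℕ => 2 * Real.pi * ((1 + 1 / (n : ℝ)) * (2 + 1 / (n : ℝ)) / 6)) atTop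
        (𝓝 (2 * Real.pi * ((1 + 0) * (2 + 0) / 6))) := by
      have h0 := tendsto_one_div_atTop_nhds_zero_nat (𝕜 := ℝ)
      exact (((h0.const_add 1).mul (h0.const_add 2)).div_const 6).const_mul _
    have e : 2 * Real.pi * ((1 + 0) * (2 + 0) / 6) = 2 * Real.pi / 3 := by ring
    rw [e] at h1
    refine h1.congr' ?_
    filter_upwards [eventually_ne_atTop 0] with n hn
    have hn' : (n : ℝ) ≠ 0 := by exact_mod_cast hn
    field_simp
  decay := ⟨2, fun n x => by
    -- With division by zero equal to `0`, the bound at `n = 0` reads `0 ≤ 0`.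
    rcases eq_or_ne n 0 with rfl | hn
    · simp [derivKernel]
    have hn' : (0 : ℝ) < n := by exact_mod_cast Nat.pos_of_ne_zero hn
    rw [derivKernel, abs_div, abs_of_pos (pow_pos hn' 3), div_mul_eq_mul_div,
      div_le_div_iff₀ (by positivity) hn']
    have := mul_le_mul_of_nonneg_right (cosKernel_succ_mul_le n x) hn'.le
    linarith⟩

/-- Its mass is exactly zero, so value and derivative decorrelate in the limit. -/
lemma isConcentrating_mixedKernel : IsConcentrating mixedKernel 0 where
  continuous := continuous_mixedKernel
  bounded := ⟨2 * Real.pi + 2 * Real.pi, fun n t => by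
    have c1 : Continuous fun ξ => valueKernel n (ξ - t) :=
      (continuous_valueKernel n).comp (by fun_prop)
    have c2 : Continuous fun ξ => derivKernel n (ξ - t) :=
      (continuous_derivKernel n).comp (by fun_prop)
    have c3 : Continuous fun ξ => mixedKernel n (ξ - t) :=
      (continuous_mixedKernel n).comp (by fun_prop)
    calc _ ≤ ∫ ξ in (0 : ℝ)..2 * Real.pi, (valueKernel n (ξ - t) + derivKernel n (ξ - t)) :=
          intervalIntegral.integral_mono_on (by positivity) (c3.abs.intervalIntegrable _ _)
            ((c1.add c2).intervalIntegrable _ _) fun ξ _ => abs_mixedKernel_le n _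
      _ = _ := intervalIntegral.integral_add (c1.intervalIntegrable _ _) (c2.intervalIntegrable _ _)
      _ ≤ _ := add_le_add (integral_valueKernel_sub_le n t) (integral_derivKernel_sub_le n t)⟩
  mass t := by
    refine tendsto_const_nhds.congr fun n => ?_
    simp only [mixedKernel]
    rw [intervalIntegral.integral_div, intervalIntegral.integral_neg, integral_sinKernel_sub]
    simp
  decay := ⟨2, fun n x => by
    rcases eq_or_ne n 0 with rfl | hn
    · simp [mixedKernel]
    have hn' : (0 : ℝ) < n := by exact_mod_cast Nat.pos_of_ne_zero hn
    rw [mixedKernel, abs_div, abs_neg, abs_of_pos (pow_pos hn' 2), div_mul_eq_mul_div,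
      div_le_div_iff₀ (by positivity) hn']
    have := mul_le_mul_of_nonneg_right (sinKernel_mul_le n x) hn'.le
    linarith⟩

end RandomTrig

namespace RandomTrig

open scoped NNReal

/-! ### Integration against the spectral measure -/

section Mixed

variable {φ : ℝ → ℝ} {M : ℝ}

lemma aestronglyMeasurable_density (hφc : ContinuousOn φ (Set.Ioo 0 (2 * Real.pi))) :
    AEStronglyMeasurable φ (volume.restrict (Set.Icc 0 (2 * Real.pi))) := by
  rw [← restrict_Ioo_eq_restrict_Icc]
  exact hφc.aestronglyMeasurable measurableSet_Ioo

lemma integrableOn_mul_density (hφc : ContinuousOn φ (Set.Ioo 0 (2 * Real.pi)))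
    (hφb : ∀ ξ ∈ Set.Icc 0 (2 * Real.pi), |φ ξ| ≤ M) {g : ℝ → ℝ} (hg : Continuous g) :
    IntegrableOn (fun ξ => φ ξ * g ξ) (Set.Icc 0 (2 * Real.pi)) := by
  have hφi : IntegrableOn φ (Set.Icc 0 (2 * Real.pi)) := by
    refine (integrable_const M).mono' (aestronglyMeasurable_density hφc) ?_
    filter_upwards [ae_restrict_mem measurableSet_Icc] with ξ hξ using hφb ξ hξ
  exact hφi.mul_continuousOn hg.continuousOn isCompact_Icc

lemma integrable_densityMeasure (hφc : ContinuousOn φ (Set.Ioo 0 (2 * Real.pi)))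
    (hφ0 : ∀ ξ ∈ Set.Icc 0 (2 * Real.pi), 0 ≤ φ ξ)
    (hφb : ∀ ξ ∈ Set.Icc 0 (2 * Real.pi), |φ ξ| ≤ M) {g : ℝ → ℝ} (hg : Continuous g) :
    Integrable g (densityMeasure φ) := by
  rw [densityMeasure, integrable_withDensity_iff_integrable_smul₀'
    (aestronglyMeasurable_density hφc).aemeasurable.ennreal_ofReal
    (Eventually.of_forall fun _ => ENNReal.ofReal_lt_top)]
  refine (integrableOn_mul_density hφc hφb hg).congr ?_
  filter_upwards [ae_restrict_mem measurableSet_Icc] with ξ hξ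
  rw [ENNReal.toReal_ofReal (hφ0 ξ hξ), smul_eq_mul]

lemma integral_densityMeasure (hφc : ContinuousOn φ (Set.Ioo 0 (2 * Real.pi)))
    (hφ0 : ∀ ξ ∈ Set.Icc 0 (2 * Real.pi), 0 ≤ φ ξ) (g : ℝ → ℝ) :
    ∫ ξ, g ξ ∂(densityMeasure φ) = ∫ ξ in (0 : ℝ)..2 * Real.pi, g ξ * φ ξ := by
  rw [densityMeasure, integral_withDensity_eq_integral_toReal_smul₀
    (aestronglyMeasurable_density hφc).aemeasurable.ennreal_ofReal
    (Eventually.of_forall fun _ => ENNReal.ofReal_lt_top),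
    intervalIntegral.integral_of_le (by positivity), ← integral_Icc_eq_integral_Ioc]
  refine setIntegral_congr_fun measurableSet_Icc fun ξ hξ => ?_
  rw [ENNReal.toReal_ofReal (hφ0 ξ hξ), smul_eq_mul, mul_comm]

lemma integrable_atomicMeasure {N : ℕ} (hN : 0 < N) (α : Fin N → ℝ) (g : ℝ → ℝ) :
    Integrable g (atomicMeasure α) := by
  rw [atomicMeasure]
  -- `N ≠ 0` keeps the weight `N⁻¹` finite in `ℝ≥0∞`.
  refine Integrable.smul_measure ?_ (by simp [hN.ne'])
  rw [integrable_finsetSum_measure]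
  intro k _
  refine Integrable.smul_measure ?_ (by simp)
  exact (integrable_dirac (by simp)).add_measure (integrable_dirac (by simp))

lemma integral_atomicMeasure {N : ℕ} (α : Fin N → ℝ) (g : ℝ → ℝ) :
    ∫ ξ, g ξ ∂(atomicMeasure α) = (N : ℝ)⁻¹ * ∑ k, (2 : ℝ)⁻¹ * (g (α k) + g (-α k)) := by
  have hd : ∀ x : ℝ, Integrable g (Measure.dirac x) := fun x => integrable_dirac (by simp)
  rw [atomicMeasure, integral_smul_measure, integral_finsetSum_measure]
  · simp_rw [integral_smul_measure, integral_add_measure (hd _) (hd _), integral_dirac]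
    simp
  · intro k _
    refine Integrable.smul_measure ?_ (by simp)
    exact (hd _).add_measure (hd _)

lemma integral_mixedMeasure {η : ℝ} (hη₀ : 0 ≤ η) (hη₁ : η < 1)
    (hφc : ContinuousOn φ (Set.Ioo 0 (2 * Real.pi)))
    (hφ0 : ∀ ξ ∈ Set.Icc 0 (2 * Real.pi), 0 ≤ φ ξ)
    (hφb : ∀ ξ ∈ Set.Icc 0 (2 * Real.pi), |φ ξ| ≤ M) {N : ℕ} (hN : 0 < N) (α : Fin N → ℝ)
    {g : ℝ → ℝ} (hg : Continuous g) :
    ∫ ξ, g ξ ∂(mixedMeasure η φ α) = (1 - η) * (∫ ξ in (0 : ℝ)..2 * Real.pi, g ξ * φ ξ) +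
      η * ((N : ℝ)⁻¹ * ∑ k, (2 : ℝ)⁻¹ * (g (α k) + g (-α k))) := by
  rw [mixedMeasure, integral_add_measure
    ((integrable_densityMeasure hφc hφ0 hφb hg).smul_measure ENNReal.ofReal_ne_top)
    ((integrable_atomicMeasure hN α g).smul_measure ENNReal.ofReal_ne_top),
    integral_smul_measure, integral_smul_measure, integral_densityMeasure hφc hφ0,
    integral_atomicMeasure, ENNReal.toReal_ofReal (by linarith), ENNReal.toReal_ofReal hη₀,
    smul_eq_mul, smul_eq_mul]

/-- The atoms contribute a nonnegative amount and are dropped. Applied to the Fejér kernel, this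
bounds the normalized variance below uniformly in `n` and `t`. -/
lemma le_integral_mixedMeasure {η : ℝ} (hη₀ : 0 ≤ η) (hη₁ : η < 1)
    (hφc : ContinuousOn φ (Set.Ioo 0 (2 * Real.pi))) {m : ℝ} (hm : 0 < m)
    (hφm : ∀ ξ ∈ Set.Icc 0 (2 * Real.pi), m ≤ φ ξ)
    (hφb : ∀ ξ ∈ Set.Icc 0 (2 * Real.pi), |φ ξ| ≤ M) {N : ℕ} (hN : 0 < N) (α : Fin N → ℝ)
    {g : ℝ → ℝ} (hg : Continuous g) (hg0 : ∀ ξ, 0 ≤ g ξ) :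
    (1 - η) * m * (∫ ξ in (0 : ℝ)..2 * Real.pi, g ξ) ≤ ∫ ξ, g ξ ∂(mixedMeasure η φ α) := by
  have hpi : (0 : ℝ) ≤ 2 * Real.pi := by positivity
  rw [integral_mixedMeasure hη₀ hη₁ hφc (fun ξ hξ => hm.le.trans (hφm ξ hξ)) hφb hN α hg]
  have h1 : 0 ≤ η * ((N : ℝ)⁻¹ * ∑ k, (2 : ℝ)⁻¹ * (g (α k) + g (-α k))) := by
    have := Finset.sum_nonneg fun k (_ : k ∈ Finset.univ) =>
      mul_nonneg (by norm_num : (0 : ℝ) ≤ 2⁻¹) (add_nonneg (hg0 (α k)) (hg0 (-α k)))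
    positivity
  have hi : IntervalIntegrable (fun ξ => g ξ * φ ξ) volume 0 (2 * Real.pi) := by
    rw [intervalIntegrable_iff_integrableOn_Icc_of_le hpi]
    simp_rw [mul_comm (g _)]
    exact integrableOn_mul_density hφc hφb hg
  have h2 : m * (∫ ξ in (0 : ℝ)..2 * Real.pi, g ξ) ≤ ∫ ξ in (0 : ℝ)..2 * Real.pi, g ξ * φ ξ := by
    rw [← intervalIntegral.integral_const_mul]
    refine intervalIntegral.integral_mono_on hpi ((hg.const_mul m).intervalIntegrable _ _) hi
      fun ξ hξ => ?_
    rw [mul_comm]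
    exact mul_le_mul_of_nonneg_left (hφm ξ hξ) (hg0 ξ)
  have h3 := mul_le_mul_of_nonneg_left h2 (by linarith : 0 ≤ 1 - η)
  linarith

lemma tendsto_integral_mixedMeasure {η : ℝ} (hη₀ : 0 ≤ η) (hη₁ : η < 1)
    (hφc : ContinuousOn φ (Set.Ioo 0 (2 * Real.pi)))
    (hφ0 : ∀ ξ ∈ Set.Icc 0 (2 * Real.pi), 0 ≤ φ ξ)
    (hφb : ∀ ξ ∈ Set.Icc 0 (2 * Real.pi), |φ ξ| ≤ M) {N : ℕ} (hN : 0 < N) (α : Fin N → ℝ)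
    {Q : ℕ → ℝ → ℝ} {c : ℝ} (hQ : IsConcentrating Q c) {t : ℝ}
    (ht : t ∈ Set.Ioo 0 (2 * Real.pi)) (htα : ∀ k, Real.cos (α k - t) ≠ 1)
    (htα' : ∀ k, Real.cos (-α k - t) ≠ 1) :
    Tendsto (fun n => ∫ ξ, Q n (ξ - t) ∂(mixedMeasure η φ α)) atTop
      (𝓝 ((1 - η) * (c * φ t))) := by
  have hcont : ∀ n, Continuous fun ξ => Q n (ξ - t) := fun n =>
    (hQ.continuous n).comp (by fun_prop)
  simp_rw [fun n => integral_mixedMeasure hη₀ hη₁ hφc hφ0 hφb hN α (hcont n)]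
  have h1 := hQ.tendsto_integral_mul (t := t) (φ := φ) (M := M)
    ((aestronglyMeasurable_density hφc).mono_measure
      (Measure.restrict_mono Set.Ioc_subset_Icc_self le_rfl)) hφb ht
    (hφc.continuousAt (isOpen_Ioo.mem_nhds ht))
  have h2 : Tendsto (fun n => η * ((N : ℝ)⁻¹ * ∑ k, (2 : ℝ)⁻¹ *
      (Q n (α k - t) + Q n (-α k - t)))) atTop
      (𝓝 (η * ((N : ℝ)⁻¹ * ∑ k : Fin N, (2 : ℝ)⁻¹ * (0 + 0)))) :=
    ((tendsto_finsetSum _ fun k _ => ((hQ.tendsto_zero (htα k)).add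
      (hQ.tendsto_zero (htα' k))).const_mul _).const_mul _).const_mul _
  have h3 := (h1.const_mul (1 - η)).add h2
  simpa using h3

lemma ae_cos_sub_ne_one (x : ℝ) : ∀ᵐ t : ℝ, Real.cos (x - t) ≠ 1 := by
  have hc : (Set.range fun k : ℤ => x - k * (2 * Real.pi)).Countable := Set.countable_range _
  filter_upwards [compl_mem_ae_iff.2 (hc.measure_zero volume)] with t ht h
  obtain ⟨k, hk⟩ := (Real.cos_eq_one_iff _).1 h
  exact ht ⟨k, by simp only; linarith⟩

end Mixed

lemma IsSpectralMeasure.continuous_integral_cosKernel {μ : Measure ℝ} {ρ : ℕ → ℝ}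
    (hμ : IsSpectralMeasure μ ρ) {n : ℕ} (p q : Fin n → ℝ) :
    Continuous fun t => ∫ ξ, cosKernel p q (ξ - t) ∂μ := by
  simp_rw [hμ.integral_cosKernel]
  fun_prop

lemma IsSpectralMeasure.continuous_integral_sinKernel {μ : Measure ℝ} {ρ : ℕ → ℝ}
    (hμ : IsSpectralMeasure μ ρ) {n : ℕ} (p q : Fin n → ℝ) :
    Continuous fun t => ∫ ξ, -sinKernel p q (ξ - t) ∂μ := by
  simp_rw [hμ.integral_sinKernel]
  fun_prop

/-- Integration over a full period in `t` keeps only the lag-zero correlation, so the bound involves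
only the total mass `ρ 0`, however concentrated the spectral measure is. -/
lemma IsSpectralMeasure.integral_integral_derivKernel_le {μ : Measure ℝ} {ρ : ℕ → ℝ}
    (hμ : IsSpectralMeasure μ ρ) (n : ℕ) :
    ∫ t in (0 : ℝ)..2 * Real.pi, (∫ ξ, derivKernel n (ξ - t) ∂μ) ≤ 2 * Real.pi * ρ 0 := by
  have := hμ.1
  have hρ : 0 ≤ ρ 0 := by
    have h := (hμ.integral_cos 0).1
    rw [← h]
    simp
  simp only [derivKernel]
  simp_rw [integral_div, hμ.integral_cosKernel]
  rw [intervalIntegral.integral_div]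
  have h := integral_cosKernel_mul_sub (succWeight n) (succWeight n) (fun m => ρ m.natAbs) 0
  simp only [sub_zero, Int.natAbs_zero] at h
  rw [h, mul_div_assoc]
  have h1 : (∑ k, succWeight n k * succWeight n k) / (n : ℝ) ^ 3 ≤ 1 :=
    div_le_one_of_le₀ (sum_succWeight_mul_self_le n) (by positivity)
  exact mul_le_of_le_one_right (by positivity) h1

end RandomTrig

/-! ### The limit theorem -/

open RandomTrig in
theorem theorem2 {Ω : Type*} [MeasurableSpace Ω] (P : Measure Ω) [IsProbabilityMeasure P]
    (a b : ℕ+ → Ω → ℝ) (ρ : ℕ → ℝ)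
    (ha : RandomTrig.IsStationaryGaussian a ρ P)
    (hb : RandomTrig.IsStationaryGaussian b ρ P)
    (hab : IndepFun (fun ω k => a k ω) (fun ω k => b k ω) P)
    (η : ℝ) (hη₀ : 0 ≤ η) (hη₁ : η < 1)
    (N : ℕ) (hN : 0 < N) (α : Fin N → ℝ) (hα : ∀ k, 0 ≤ α k)
    (φ : ℝ → ℝ)
    (hA1 : ContinuousOn φ (Set.Ioo 0 (2 * Real.pi)))
    (hA2 : ∃ m : ℝ, 0 < m ∧ ∀ t ∈ Set.Icc 0 (2 * Real.pi), m ≤ φ t)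
    (hA3 : ∃ M : ℝ, ∀ t ∈ Set.Icc 0 (2 * Real.pi), |φ t| ≤ M)
    (hμ : RandomTrig.IsSpectralMeasure (RandomTrig.mixedMeasure η φ α) ρ) :
    (∀ n : ℕ, AEMeasurable
      (fun ω => RandomTrig.numZeros (RandomTrig.trigPoly a b n ω)
        (Set.Icc 0 (2 * Real.pi))) P) ∧
    Tendsto
      (fun n : ℕ =>
        (∫⁻ ω, RandomTrig.numZeros (RandomTrig.trigPoly a b n ω)
          (Set.Icc 0 (2 * Real.pi)) ∂P) / (n : ℝ≥0∞))
      atTop (𝓝 (ENNReal.ofReal (2 / Real.sqrt 3))) := by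
  refine ⟨fun n => aemeasurable_numZeros_trigPoly ha hb hab n _ _, ?_⟩
  obtain ⟨m, hm, hφm⟩ := hA2
  obtain ⟨M, hφb⟩ := hA3
  have hφ0 : ∀ ξ ∈ Set.Icc 0 (2 * Real.pi), 0 ≤ φ ξ := fun ξ hξ => hm.le.trans (hφm ξ hξ)
  set μ := mixedMeasure η φ α with hμdef
  have hpi := Real.pi_pos
  set v : ℕ → ℝ → ℝ := fun n t => ∫ ξ, valueKernel n (ξ - t) ∂μ with hv
  set d : ℕ → ℝ → ℝ := fun n t => ∫ ξ, derivKernel n (ξ - t) ∂μ with hd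
  set w : ℕ → ℝ → ℝ := fun n t => ∫ ξ, mixedKernel n (ξ - t) ∂μ with hw
  have hvc : ∀ n, Continuous (v n) := fun n => by
    simp only [hv, valueKernel, integral_div]
    exact (hμ.continuous_integral_cosKernel _ _).div_const _
  have hdc : ∀ n, Continuous (d n) := fun n => by
    simp only [hd, derivKernel, integral_div]
    exact (hμ.continuous_integral_cosKernel _ _).div_const _
  have hwc : ∀ n, Continuous (w n) := fun n => by
    simp only [hw, mixedKernel, integral_div]
    exact (hμ.continuous_integral_sinKernel _ _).div_const _
  have hd0 : ∀ n t, 0 ≤ d n t := fun n t => integral_nonneg fun ξ => derivKernel_nonneg n _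
  set v₀ : ℝ := (1 - η) * m * (2 * Real.pi) with hv₀
  have hη : 0 < 1 - η := by linarith
  have hv₀pos : 0 < v₀ := by positivity
  have hvlow : ∀ n, n ≠ 0 → ∀ t, v₀ ≤ v n t := by
    intro n hn t
    have := le_integral_mixedMeasure hη₀ hη₁ hA1 hm hφm hφb hN α
      (g := fun ξ => valueKernel n (ξ - t)) ((continuous_valueKernel n).comp (by fun_prop))
      (fun ξ => valueKernel_nonneg n _)
    rwa [integral_valueKernel_sub hn] at this
  set s : ℕ → ℝ → ℝ := fun n t => √((v n t * d n t - w n t ^ 2) / v n t ^ 2) with hs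
  -- The variances and covariance are `n * v`, `n ^ 3 * d` and `n ^ 2 * w`, so the Kac–Rice quotient
  -- is `n ^ 2` times that of `v`, `d`, `w`; its square root supplies the factor `n`.
  have hformula : ∀ n, n ≠ 0 →
      (∫⁻ ω, numZeros (trigPoly a b n ω) (Set.Icc 0 (2 * Real.pi)) ∂P) / (n : ℝ≥0∞) =
        ∫⁻ t in Set.Icc 0 (2 * Real.pi), ENNReal.ofReal (Real.pi⁻¹ * s n t) := by
    intro n hn
    have hn' : (0 : ℝ) < n := by exact_mod_cast Nat.pos_of_ne_zero hn
    have e1 : ∀ t, ∫ ξ, cosKernel (onesWeight n) (onesWeight n) (ξ - t) ∂μ = n * v n t := by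
      intro t
      simp only [hv, valueKernel, integral_div]
      field_simp
    have e2 : ∀ t, ∫ ξ, cosKernel (succWeight n) (succWeight n) (ξ - t) ∂μ = n ^ 3 * d n t := by
      intro t
      simp only [hd, derivKernel, integral_div]
      field_simp
    have e3 : ∀ t, ∫ ξ, -sinKernel (onesWeight n) (succWeight n) (ξ - t) ∂μ = n ^ 2 * w n t := by
      intro t
      simp only [hw, mixedKernel, integral_div]
      field_simp
    rw [lintegral_numZeros_trigPoly ha hb hab hn 0 (2 * Real.pi)
      (fun t => (integral_eval_mul_eval ha hb hab hμ n t).trans (e1 t))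
      (fun t => (integral_eval_mul_deriv ha hb hab hμ n t).trans (e3 t))
      (fun t => (integral_deriv_mul_deriv ha hb hab hμ n t).trans (e2 t))
      (fun t => mul_pos hn' (hv₀pos.trans_le (hvlow n hn t)))]
    have e4 : ∀ t, ENNReal.ofReal (Real.pi⁻¹ * √((n * v n t * (n ^ 3 * d n t) -
        (n ^ 2 * w n t) ^ 2) / (n * v n t) ^ 2)) =
        ENNReal.ofReal (Real.pi⁻¹ * s n t) * (n : ℝ≥0∞) := by
      intro t
      have hvne : v n t ≠ 0 := (hv₀pos.trans_le (hvlow n hn t)).ne'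
      have e5 : (n * v n t * (n ^ 3 * d n t) - (n ^ 2 * w n t) ^ 2) / (n * v n t) ^ 2 =
          (v n t * d n t - w n t ^ 2) / v n t ^ 2 * n ^ 2 := by
        field_simp
      rw [e5, Real.sqrt_mul' _ (by positivity), Real.sqrt_sq hn'.le, ← ENNReal.ofReal_natCast n,
        ← ENNReal.ofReal_mul (mul_nonneg (by positivity) (Real.sqrt_nonneg _)), mul_assoc]
    simp_rw [e4]
    rw [lintegral_mul_const' _ _ (by simp), mul_div_assoc,
      ENNReal.div_self (by exact_mod_cast hn) (by simp), mul_one]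
  have hsc : ∀ n, n ≠ 0 → Continuous (s n) := by
    intro n hn
    refine Continuous.sqrt (Continuous.div₀ ?_ ?_ ?_)
    · exact ((hvc n).mul (hdc n)).sub ((hwc n).pow 2)
    · exact (hvc n).pow 2
    · exact fun t => pow_ne_zero 2 (hv₀pos.trans_le (hvlow n hn t)).ne'
  -- The covariance term only lowers the quotient, and one factor `v n t` cancels before the lower
  -- bound `v₀` is used.
  have hsq : ∀ n, n ≠ 0 → ∀ t, s n t ^ 2 ≤ d n t / v₀ := by
    intro n hn t
    have hvpos := hv₀pos.trans_le (hvlow n hn t)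
    have h1 : (v n t * d n t - w n t ^ 2) / v n t ^ 2 ≤ d n t / v n t := by
      rw [div_le_div_iff₀ (by positivity) hvpos]
      nlinarith [mul_nonneg (sq_nonneg (w n t)) hvpos.le]
    have h2 : d n t / v n t ≤ d n t / v₀ :=
      div_le_div_of_nonneg_left (hd0 n t) hv₀pos (hvlow n hn t)
    have h3 : 0 ≤ d n t / v₀ := div_nonneg (hd0 n t) hv₀pos.le
    calc s n t ^ 2 ≤ √(d n t / v₀) ^ 2 :=
          pow_le_pow_left₀ (Real.sqrt_nonneg _) (Real.sqrt_le_sqrt (h1.trans h2)) 2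
      _ = d n t / v₀ := Real.sq_sqrt h3
  have hlim : ∀ᵐ t ∂(volume.restrict (Set.Icc 0 (2 * Real.pi))),
      Tendsto (fun n => s n t) atTop (𝓝 √(1 / 3)) := by
    rw [← restrict_Ioo_eq_restrict_Icc]
    filter_upwards [ae_restrict_mem measurableSet_Ioo,
      ae_restrict_of_ae (ae_all_iff.2 fun k => ae_cos_sub_ne_one (α k)),
      ae_restrict_of_ae (ae_all_iff.2 fun k => ae_cos_sub_ne_one (-α k))] with t ht h1 h2
    have T : ∀ {Q : ℕ → ℝ → ℝ} {c : ℝ}, IsConcentrating Q c → _ := fun hQ =>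
      tendsto_integral_mixedMeasure hη₀ hη₁ hA1 hφ0 hφb hN α hQ ht h1 h2
    have hφt : 0 < φ t := hm.trans_le (hφm t ⟨ht.1.le, ht.2.le⟩)
    have tv : Tendsto (fun n => v n t) atTop (𝓝 ((1 - η) * (2 * Real.pi * φ t))) :=
      T isConcentrating_valueKernel
    have td : Tendsto (fun n => d n t) atTop (𝓝 ((1 - η) * (2 * Real.pi / 3 * φ t))) :=
      T isConcentrating_derivKernel
    have tw : Tendsto (fun n => w n t) atTop (𝓝 ((1 - η) * (0 * φ t))) :=
      T isConcentrating_mixedKernel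
    have hne : ((1 - η) * (2 * Real.pi * φ t)) ^ 2 ≠ 0 := by positivity
    have h := ((((tv.mul td).sub (tw.pow 2)).div (tv.pow 2) hne).sqrt)
    have hval : ((1 - η) * (2 * Real.pi * φ t) * ((1 - η) * (2 * Real.pi / 3 * φ t)) -
        ((1 - η) * (0 * φ t)) ^ 2) / ((1 - η) * (2 * Real.pi * φ t)) ^ 2 = 1 / 3 := by
      rw [div_eq_iff hne]
      ring
    rwa [hval] at h
  -- The index is shifted by one since the lower bound on `v n` fails at `n = 0`, where the kernels
  -- vanish.
  have hsi : ∀ n, IntegrableOn (fun t => s (n + 1) t ^ 2) (Set.Icc 0 (2 * Real.pi)) :=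
    fun n => ((hsc (n + 1) n.succ_ne_zero).pow 2).integrableOn_Icc
  have hconv : Tendsto (fun n => ∫ t in Set.Icc 0 (2 * Real.pi), s (n + 1) t) atTop
      (𝓝 (∫ _ in Set.Icc 0 (2 * Real.pi), √(1 / 3))) := by
    refine tendsto_integral_of_sq_bounded (C := 2 * Real.pi * ρ 0 / v₀)
      (fun n t => Real.sqrt_nonneg _)
      (fun n => (hsc (n + 1) n.succ_ne_zero).aestronglyMeasurable)
      hsi
      (Eventually.of_forall fun n => ?_) ?_
    · calc ∫ t in Set.Icc 0 (2 * Real.pi), s (n + 1) t ^ 2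
          ≤ ∫ t in Set.Icc 0 (2 * Real.pi), d (n + 1) t / v₀ :=
            integral_mono (hsi n)
              ((hdc (n + 1)).div_const v₀).integrableOn_Icc (hsq (n + 1) n.succ_ne_zero)
        _ = (∫ t in (0 : ℝ)..2 * Real.pi, d (n + 1) t) / v₀ := by
            rw [integral_div, intervalIntegral.integral_of_le (by positivity),
              integral_Icc_eq_integral_Ioc]
        _ ≤ _ := div_le_div_of_nonneg_right (hμ.integral_integral_derivKernel_le (n + 1)) hv₀pos.le
    · filter_upwards [hlim] with t ht
      exact ht.comp (tendsto_add_atTop_nat 1)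
  rw [← tendsto_add_atTop_iff_nat 1]
  have hval : Real.pi⁻¹ * (∫ _ in Set.Icc 0 (2 * Real.pi), √(1 / 3)) = 2 / √3 := by
    rw [setIntegral_const, smul_eq_mul, Real.volume_real_Icc_of_le (by positivity),
      Real.sqrt_div zero_le_one, Real.sqrt_one]
    field_simp
    ring
  rw [← hval]
  refine (ENNReal.tendsto_ofReal (hconv.const_mul Real.pi⁻¹)).congr fun n => ?_
  rw [hformula (n + 1) n.succ_ne_zero, ← integral_const_mul,
    ofReal_integral_eq_lintegral_ofReal
      ((hsc (n + 1) n.succ_ne_zero).const_mul _).integrableOn_Icc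
      (Eventually.of_forall fun t => mul_nonneg (by positivity) (Real.sqrt_nonneg _))]
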